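/- Let $X$ be a smooth $n$-dimensional manifold, and let $(g_t,\Omega_t)$, for $t$ near $0$, be a smooth curve of pairs consisting of a Riemannian metric and a nowhere vanishing $n$-form on $X$ (a positive volume form for the orientation it defines), with $(g_0,\Omega_0)=(g,\Omega)$ and velocity $(\dot g_0,\dot\Omega_0)=(v,V)$; in particular any smooth curve of metrics and positive volume forms of unit integral on a compact connected oriented $X$ is allowed. Write $\nabla_g$ for the Levi-Civita connection (with $\nabla_g u(\xi,\eta,\mu)=(\nabla_{g,\xi}u)(\eta,\mu)$) and for the gradient, $f_{g,\Omega}=\log\frac{dV_g}{\Omega}$, $v_g^*=g^{-1}v$, $\alpha_g^*=g^{-1}\alpha$, $V_\Omega^*=V/\Omega$, and let $(e_k)_k$ denote a $g$-orthonormal basis of the tangent space, with summation over $k$. Put $$\nabla_g^*u=-\nabla_gu(e_k,e_k,\cdot),\qquad \nabla_g^*A=-(\nabla_{g,e_k}A)e_k,\qquad \nabla_g^{*_\Omega}=e^{f}\,\nabla_g^*\,(e^{-f}\,\cdot\,)\qquad (f=f_{g,\Omega})$$ for symmetric $2$-tensors $u$ and for endomorphism fields $A$ of $T_X$; for $1$-forms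 $\alpha$ put $$\operatorname{div}_g^\Omega\alpha=\nabla_g\alpha(e_k,e_k)-\alpha(\nabla_gf),$$ and for symmetric $2$-tensors $u,v$ and a tangent vector $\xi$ put $$M_g(u,v)(\xi)=2\,\nabla_gv(e_k,u_g^*e_k,\xi)+\nabla_gu(\xi,v_g^*e_k,e_k).$$ **Lemma.** (1) For every smooth symmetric covariant $2$-tensor $u$, at every point of $X$, $$2\,\frac{d}{dt}\Big|_{t=0}\nabla_{g_t}^{*_{\Omega_t}}u \;=\; M_g(v,u)-2\,u\cdot\left(\nabla_g^{*_\Omega}v_g^*+\nabla_gV_\Omega^*\right).$$ (2) For every smooth $1$-form $\alpha$, at every point of $X$, $$\frac{d}{dt}\Big|_{t=0}\operatorname{div}_{g_t}^{\Omega_t}\alpha \;=\; -\langle\nabla_g\alpha_g^*,v_g^*\rangle_g+\alpha\cdot\left(\nabla_g^{*_\Omega}v_g^*+\nabla_gV_\Omega^*\right).$$ -/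

import Mathlib

open scoped Manifold ContDiff Bundle

noncomputable section

namespace WeightedVariation

/-- The model space `ℝⁿ`. -/
abbrev Model (n : ℕ) : Type := EuclideanSpace ℝ (Fin n)

section Fields

variable (n : ℕ) (X : Type*) [TopologicalSpace X] [ChartedSpace (Model n) X]

/-- Smooth Riemannian metrics on `X` (the space `𝓜`). -/
abbrev Metric [IsManifold (𝓡 n) ∞ X] : Type _ :=
  Bundle.ContMDiffRiemannianMetric (𝓡 n) ∞ (Model n) (fun x : X => TangentSpace (𝓡 n) x)

/-- Vector fields. -/
abbrev VField : Type _ := (x : X) → TangentSpace (𝓡 n) x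

/-- Real valued `1`-forms. -/
abbrev OneForm : Type _ := (x : X) → TangentSpace (𝓡 n) x →L[ℝ] ℝ

/-- Covariant `2`-tensors. -/
abbrev Tensor2 : Type _ :=
  (x : X) → TangentSpace (𝓡 n) x →L[ℝ] TangentSpace (𝓡 n) x →L[ℝ] ℝ

/-- Sections of `End (T_X)`. -/
abbrev EndField : Type _ := (x : X) → TangentSpace (𝓡 n) x →L[ℝ] TangentSpace (𝓡 n) x

/-- Differential forms of top degree. -/
abbrev TopForm : Type _ := (x : X) → (TangentSpace (𝓡 n) x) [⋀^Fin n]→ₗ[ℝ] ℝ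

end Fields

variable {n : ℕ} {X : Type*} [TopologicalSpace X] [ChartedSpace (Model n) X]

/-! ### Smoothness -/

/-- Smooth `1`-forms: smooth sections of the cotangent bundle. -/
def OneForm.Smooth [IsManifold (𝓡 n) ∞ X] (α : OneForm n X) : Prop :=
  ContMDiff (𝓡 n) ((𝓡 n).prod 𝓘(ℝ, Model n →L[ℝ] ℝ)) ∞
    (fun x : X => Bundle.TotalSpace.mk' (E := fun x : X => TangentSpace (𝓡 n) x →L[ℝ] ℝ)
      (Model n →L[ℝ] ℝ) x (α x))

/-- Smooth covariant `2`-tensors: smooth sections of `T_X^* ⊗ T_X^*`. -/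
def Tensor2.Smooth [IsManifold (𝓡 n) ∞ X] (u : Tensor2 n X) : Prop :=
  ContMDiff (𝓡 n) ((𝓡 n).prod 𝓘(ℝ, Model n →L[ℝ] Model n →L[ℝ] ℝ)) ∞
    (fun x : X => Bundle.TotalSpace.mk'
      (E := fun x : X => TangentSpace (𝓡 n) x →L[ℝ] TangentSpace (𝓡 n) x →L[ℝ] ℝ)
      (Model n →L[ℝ] Model n →L[ℝ] ℝ) x (u x))

/-- Symmetric covariant `2`-tensors. -/
def Tensor2.Symmetric (u : Tensor2 n X) : Prop :=
  ∀ (x : X) (a b : TangentSpace (𝓡 n) x), u x a b = u x b a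

/-- The coordinate frame of the chart around `p`: the differential at the coordinate point `y` of
the inverse chart, `a ↦ ∑ aⁱ ∂ᵢ`. -/
def coordFrame (p : X) (y : Model n) :
    Model n →L[ℝ] TangentSpace (𝓡 n) ((extChartAt (𝓡 n) p).symm y) :=
  mfderiv 𝓘(ℝ, Model n) (𝓡 n) (extChartAt (𝓡 n) p).symm y

/-- The standard basis of the fibre `T_x X`, which in Mathlib is the model space `ℝⁿ`; it consists
of the coordinate vectors at `x` of the preferred chart around `x`. -/
def basisVec (x : X) (i : Fin n) : TangentSpace (𝓡 n) x :=
  (EuclideanSpace.single i (1 : ℝ) : Model n)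

/-- The component `Ω(∂₁, …, ∂ₙ)` of a top degree form in the chart around `p`. -/
def coordTop (p : X) (Ω : TopForm n X) (y : Model n) : ℝ :=
  Ω ((extChartAt (𝓡 n) p).symm y)
    (fun i => coordFrame p y (EuclideanSpace.single i (1 : ℝ) : Model n))

/-! ### Pointwise algebra of a metric -/

variable [IsManifold (𝓡 n) ∞ X]

/-- The Gram matrix `(g_{ij})` of `g` at `x`. -/
def gram (g : Metric n X) (x : X) : Matrix (Fin n) (Fin n) ℝ :=
  fun i j => g.inner x (basisVec x i) (basisVec x j)

/-- The vector `g⁻¹ α` for a covector `α`, that is `g (g⁻¹ α, b) = α b`. -/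
def sharp (g : Metric n X) (x : X) (α : TangentSpace (𝓡 n) x → ℝ) : TangentSpace (𝓡 n) x :=
  ∑ i, ∑ j, ((gram g x)⁻¹ i j * α (basisVec x i)) • basisVec x j

/-- The trace `∑ₖ B (eₖ, eₖ) = ∑ᵢⱼ gⁱʲ B (∂ᵢ, ∂ⱼ)`, with `(eₖ)` any `g`-orthonormal basis,
of a vector valued bilinear map on `T_x X`. -/
def metricTrace {F : Type*} [AddCommGroup F] [Module ℝ F] (g : Metric n X) (x : X)
    (B : TangentSpace (𝓡 n) x → TangentSpace (𝓡 n) x → F) : F :=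
  ∑ i, ∑ j, (gram g x)⁻¹ i j • B (basisVec x i) (basisVec x j)

/-- The endomorphism `v^*_g = g⁻¹ v` of a symmetric `2`-tensor, that is `g (v^*_g a, b) = v (a, b)`. -/
def Tensor2.star (g : Metric n X) (v : Tensor2 n X) : EndField n X :=
  fun x => ∑ i, ∑ j, (gram g x)⁻¹ i j •
    ((v x (basisVec x i)).smulRight (basisVec x j))

/-- The vector field `α^*_g = g⁻¹ α`. -/
def OneForm.star (g : Metric n X) (α : OneForm n X) : VField n X :=
  fun x => sharp g x (α x)

/-- The gradient `∇_g φ` of a function. -/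
def grad (g : Metric n X) (φ : X → ℝ) : VField n X :=
  fun x => sharp g x (fun a => mfderiv (𝓡 n) 𝓘(ℝ, ℝ) φ x a)

/-! ### Levi-Civita covariant derivatives

Values at `p` are computed in the preferred chart around `p`, whose differential at `p` is
the identity under Mathlib's identification `T_p X = ℝⁿ`. -/

/-- The partial derivative at `p`, in the direction `a`, of the component `u(b, c)` of a covariant
`2`-tensor in the chart around `p`. -/
def partial2 (u : Tensor2 n X) (p : X) (a b c : TangentSpace (𝓡 n) p) : ℝ :=
  fderiv ℝ (fun y : Model n =>
    u ((extChartAt (𝓡 n) p).symm y) (coordFrame p y b) (coordFrame p y c))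
    (extChartAt (𝓡 n) p p) a

/-- The partial derivative at `p` of the component `α(b)` of a `1`-form. -/
def partial1 (α : OneForm n X) (p : X) (a b : TangentSpace (𝓡 n) p) : ℝ :=
  fderiv ℝ (fun y : Model n => α ((extChartAt (𝓡 n) p).symm y) (coordFrame p y b))
    (extChartAt (𝓡 n) p p) a

/-- The partial derivative at `p` of the coordinate expression of a vector field. -/
def partialVec (Z : VField n X) (p : X) (a : TangentSpace (𝓡 n) p) : TangentSpace (𝓡 n) p :=
  fderiv ℝ (fun y : Model n => (coordFrame p y).inverse (Z ((extChartAt (𝓡 n) p).symm y)))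
    (extChartAt (𝓡 n) p p) a

/-- The partial derivative at `p` of the coordinate expression of `A b`, where `A` is an
endomorphism field and `b` has constant coordinates. -/
def partialEnd (A : EndField n X) (p : X) (a b : TangentSpace (𝓡 n) p) : TangentSpace (𝓡 n) p :=
  fderiv ℝ (fun y : Model n =>
    (coordFrame p y).inverse (A ((extChartAt (𝓡 n) p).symm y) (coordFrame p y b)))
    (extChartAt (𝓡 n) p p) a

/-- The Christoffel symbols at `p`:
`g (Γ(a, b), c) = ½ (∂ₐ g(b, c) + ∂_b g(a, c) - ∂_c g(a, b))`. -/
def christoffel (g : Metric n X) (p : X) (a b : TangentSpace (𝓡 n) p) : TangentSpace (𝓡 n) p :=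
  sharp g p (fun c => (1 / 2 : ℝ) *
    (partial2 g.inner p a b c + partial2 g.inner p b a c - partial2 g.inner p c a b))

/-- `∇_g u (a, b, c) = (∇_{g,a} u)(b, c)` for a covariant `2`-tensor. -/
def nabla2 (g : Metric n X) (u : Tensor2 n X) (p : X) (a b c : TangentSpace (𝓡 n) p) : ℝ :=
  partial2 u p a b c - u p (christoffel g p a b) c - u p b (christoffel g p a c)

/-- `∇_g α (a, b) = (∇_{g,a} α)(b)` for a `1`-form. -/
def nabla1 (g : Metric n X) (α : OneForm n X) (p : X) (a b : TangentSpace (𝓡 n) p) : ℝ :=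
  partial1 α p a b - α p (christoffel g p a b)

/-- `∇_{g,a} Z` for a vector field. -/
def nablaVec (g : Metric n X) (Z : VField n X) (p : X) (a : TangentSpace (𝓡 n) p) :
    TangentSpace (𝓡 n) p :=
  partialVec Z p a + christoffel g p a (Z p)

/-- `(∇_{g,a} A) b` for an endomorphism field. -/
def nablaEnd (g : Metric n X) (A : EndField n X) (p : X) (a b : TangentSpace (𝓡 n) p) :
    TangentSpace (𝓡 n) p :=
  partialEnd A p a b + christoffel g p a (A p b) - A p (christoffel g p a b)

/-! ### Weighted operators -/

/-- The function `f = log (dV_g / Ω)`. Here `dV_g` is the Riemannian volume form for the orientation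
in which the nowhere zero form `Ω` is positive, so that `dV_g / Ω = √det (g(bᵢ, bⱼ)) / |Ω(b)|` for
every basis `b` of the tangent space. -/
def logDensity (g : Metric n X) (Ω : TopForm n X) (x : X) : ℝ :=
  Real.log (Real.sqrt (gram g x).det / |Ω x (basisVec x)|)

/-- The function `V^*_Ω = V / Ω`. -/
def TopForm.ratio (V Ω : TopForm n X) (x : X) : ℝ :=
  V x (basisVec x) / Ω x (basisVec x)

/-- `∇_g^* u (ξ) = - ∑ₖ ∇_g u (eₖ, eₖ, ξ)` for a symmetric `2`-tensor. -/
def adj2 (g : Metric n X) (u : Tensor2 n X) (x : X) (ξ : TangentSpace (𝓡 n) x) : ℝ :=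
  - metricTrace g x (fun a b => nabla2 g u x a b ξ)

/-- `∇_g^* A = - ∑ₖ (∇_{g,eₖ} A) eₖ` for an endomorphism field. -/
def adjEnd (g : Metric n X) (A : EndField n X) (x : X) : TangentSpace (𝓡 n) x :=
  - metricTrace g x (fun a b => nablaEnd g A x a b)

/-- `∇_g^{*_Ω} u = e^f ∇_g^* (e^{-f} u)` for a symmetric `2`-tensor, a `1`-form. -/
def weightedAdj2 (g : Metric n X) (Ω : TopForm n X) (u : Tensor2 n X) (x : X)
    (ξ : TangentSpace (𝓡 n) x) : ℝ :=
  Real.exp (logDensity g Ω x) * adj2 g (fun y => Real.exp (-logDensity g Ω y) • u y) x ξ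

/-- `∇_g^{*_Ω} A = e^f ∇_g^* (e^{-f} A)` for an endomorphism field, a vector field. -/
def weightedAdjEnd (g : Metric n X) (Ω : TopForm n X) (A : EndField n X) : VField n X :=
  fun x => Real.exp (logDensity g Ω x) •
    adjEnd g (fun y => Real.exp (-logDensity g Ω y) • A y) x

/-- `div_g^Ω α = ∑ₖ ∇_g α (eₖ, eₖ) - α (∇_g f)` for a `1`-form. -/
def weightedDiv (g : Metric n X) (Ω : TopForm n X) (α : OneForm n X) (x : X) : ℝ :=
  metricTrace g x (fun a b => nabla1 g α x a b) - α x (grad g (logDensity g Ω) x)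

/-- The `1`-form
`M_g (u, v) (ξ) = ∑ₖ (2 ∇_g v (eₖ, u^*_g eₖ, ξ) + ∇_g u (ξ, v^*_g eₖ, eₖ))`. -/
def mForm (g : Metric n X) (u v : Tensor2 n X) (x : X) (ξ : TangentSpace (𝓡 n) x) : ℝ :=
  metricTrace g x (fun a b =>
    2 * nabla2 g v x a (u.star g x b) ξ + nabla2 g u x ξ (v.star g x a) b)

/-! ### Variations -/

/-- `(g_t, Ω_t)` is, for `t` near `0`, a smooth curve of pairs of a Riemannian metric and a nowhere
zero top degree form, and its velocity at `t = 0` is `(v, V)`. -/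
structure IsVariation (g : ℝ → Metric n X) (Ω : ℝ → TopForm n X)
    (v : Tensor2 n X) (V : TopForm n X) : Prop where
  smooth : ∃ ε : ℝ, 0 < ε ∧
    ContMDiffOn (𝓘(ℝ, ℝ).prod (𝓡 n)) ((𝓡 n).prod 𝓘(ℝ, Model n →L[ℝ] Model n →L[ℝ] ℝ)) ∞
      (fun q : ℝ × X => Bundle.TotalSpace.mk'
        (E := fun x : X => TangentSpace (𝓡 n) x →L[ℝ] TangentSpace (𝓡 n) x →L[ℝ] ℝ)
        (Model n →L[ℝ] Model n →L[ℝ] ℝ) q.2 ((g q.1).inner q.2))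
      (Set.Ioo (-ε) ε ×ˢ Set.univ) ∧
    (∀ p : X, ContDiffOn ℝ ∞ (fun q : ℝ × Model n => coordTop p (Ω q.1) q.2)
      (Set.Ioo (-ε) ε ×ˢ (extChartAt (𝓡 n) p).target)) ∧
    ∀ t ∈ Set.Ioo (-ε) ε, ∀ x : X, Ω t x ≠ 0
  metric_velocity : ∀ (x : X) (a b : TangentSpace (𝓡 n) x),
    HasDerivAt (fun t => (g t).inner x a b) (v x a b) 0
  form_velocity : ∀ (x : X) (b : Fin n → TangentSpace (𝓡 n) x),
    HasDerivAt (fun t => Ω t x b) (V x b) 0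

end WeightedVariation

end

/-! Fix a point `p` and work in the preferred chart at `p`, whose frame is the identity at `p`.
There every operator is an algebraic expression in the first jets of `g_t`, `u`, `α` and in `df_t`:
the weights `e^{±f}` only add `u(∇f, ·)` to `∇^* u`, and `weightedDiv` subtracts `α(∇f)`. So only
three variations are needed. (a) The inverse metric varies by `-g⁻¹ v g⁻¹`
(`IsMetric.hasDerivAt_sharpOf`, `IsMetric.hasDerivAt_traceOf`). (b) The connection varies by the
tensor `Γ'` with `g(Γ'(a,b), c) = ½ (∇v(a,b,c) + ∇v(b,a,c) - ∇v(c,a,b))`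
(`hasDerivAt_christoffelOf`). (c) The differential of `f = log (dV_g / Ω)` varies by `½ d(tr_g v) -
d(V/Ω)`, by Jacobi's formula and the symmetry of second derivatives
(`hasDerivAt_fderiv_logDensityOf`). The trace of `Γ'` is dual to `∑ₖ ∇v(eₖ,eₖ,·) - ½ d(tr_g v)`, and
its last term cancels the one in (c). What remains is the vector `∇^{*_Ω} v^* + ∇V^*`
(`weightedAdjEnd_add_grad_eq`), on which `u` or `α` is evaluated in both formulas. The other terms
come from (a), and, for `2`-tensors, from the Christoffel symbol acting on the free slot `ξ`:
contracted with the symmetric `u`, two of its three terms cancel and the second term of `M_g` is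
left (`traceOf_chrisVar_star`). The formulas for curves of metrics are used twice: in time, and
along straight lines in the chart, where they show that traces and raising of indices commute with
`∇`. -/

noncomputable section

namespace WeightedVariation

set_option synthInstance.maxHeartbeats 200000

/-! ### Linear algebra of a nondegenerate bilinear form on `ℝⁿ` -/

section LinearAlgebra

variable {n : ℕ}

/-- The standard basis of `ℝⁿ`. -/
abbrev stdVec (i : Fin n) : Model n := EuclideanSpace.single i (1 : ℝ)

/-- Bilinear forms on the model space. -/
abbrev Bilin (n : ℕ) : Type := Model n →L[ℝ] Model n →L[ℝ] ℝ

/-- The Gram matrix of a bilinear form in the standard basis. -/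
def gramOf (G : Bilin n) : Matrix (Fin n) (Fin n) ℝ := fun i j => G (stdVec i) (stdVec j)

/-- The vector dual to a covector with respect to `G`. -/
def sharpOf (G : Bilin n) (α : Model n → ℝ) : Model n :=
  ∑ i, ∑ j, ((gramOf G)⁻¹ i j * α (stdVec i)) • stdVec j

/-- The trace of a bilinear map with respect to `G`. -/
def traceOf {F : Type*} [AddCommGroup F] [Module ℝ F] (G : Bilin n)
    (B : Model n → Model n → F) : F :=
  ∑ i, ∑ j, (gramOf G)⁻¹ i j • B (stdVec i) (stdVec j)

/-- Symmetric nondegenerate bilinear forms. -/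
structure IsMetric (G : Bilin n) : Prop where
  symm : ∀ a b, G a b = G b a
  isUnit_det : IsUnit (gramOf G).det

lemma sum_smul_stdVec (a : Model n) : ∑ i, a i • stdVec i = a := by
  ext k
  simp [Finset.sum_apply, Pi.single_apply]

lemma map_eq_sum {F : Type*} [AddCommGroup F] [Module ℝ F] (L : Model n →ₗ[ℝ] F) (a : Model n) :
    L a = ∑ i, a i • L (stdVec i) := by
  conv_lhs => rw [← sum_smul_stdVec a]
  simp

variable {G : Bilin n}

lemma IsMetric.gram_symm (hG : IsMetric G) : (gramOf G).transpose = gramOf G := by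
  ext i j
  exact hG.symm _ _

lemma IsMetric.inv_symm (hG : IsMetric G) (i j : Fin n) :
    (gramOf G)⁻¹ i j = (gramOf G)⁻¹ j i := by
  have := congrFun (congrFun (Matrix.transpose_nonsing_inv (gramOf G)) j) i
  rw [hG.gram_symm] at this
  exact this

lemma map_sharpOf (β : Model n →L[ℝ] ℝ) (α : Model n → ℝ) :
    β (sharpOf G α) = ∑ i, ∑ j, (gramOf G)⁻¹ i j * α (stdVec i) * β (stdVec j) := by
  simp [sharpOf]

lemma IsMetric.apply_sharpOf (hG : IsMetric G) (α : Model n →L[ℝ] ℝ) (b : Model n) :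
    G (sharpOf G α) b = α b := by
  have key : ∀ k, G (sharpOf G α) (stdVec k) = α (stdVec k) := by
    intro k
    have h1 : ∀ i, ∑ j, (gramOf G)⁻¹ i j * gramOf G j k = if i = k then 1 else 0 := by
      intro i
      have := congrFun (congrFun (Matrix.nonsing_inv_mul (gramOf G) hG.isUnit_det) i) k
      rwa [Matrix.mul_apply, Matrix.one_apply] at this
    have h2 : G (sharpOf G α) (stdVec k)
        = ∑ i, ∑ j, ((gramOf G)⁻¹ i j * α (stdVec i)) * gramOf G j k := by
      simp [sharpOf, gramOf]
    rw [h2]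
    have h3 : ∀ i, ∑ j, ((gramOf G)⁻¹ i j * α (stdVec i)) * gramOf G j k
        = α (stdVec i) * if i = k then 1 else 0 := by
      intro i
      rw [← h1 i, Finset.mul_sum]
      exact Finset.sum_congr rfl fun j _ => by ring
    simp [h3]
  have e1 := map_eq_sum (G (sharpOf G α) : Model n →ₗ[ℝ] ℝ) b
  have e2 := map_eq_sum (α : Model n →ₗ[ℝ] ℝ) b
  simp only [ContinuousLinearMap.coe_coe] at e1 e2
  rw [e1, e2]
  simp [key]

/-- Nondegeneracy makes the dual vector unique. This gives its behaviour under a change of frame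
without transforming inverse matrices. -/
lemma IsMetric.eq_sharpOf (hG : IsMetric G) {z : Model n} {α : Model n → ℝ}
    (h : ∀ b, G z b = α b) : z = sharpOf G α := by
  have hα : α = G z := funext fun b => (h b).symm
  rw [hα]
  have hH : ∀ j, ∑ k, ∑ i, (z k * gramOf G k i) * (gramOf G)⁻¹ i j = z j := by
    intro j
    have h1 : ∀ k, ∑ i, gramOf G k i * (gramOf G)⁻¹ i j = if k = j then 1 else 0 := by
      intro k
      have := congrFun (congrFun (Matrix.mul_nonsing_inv (gramOf G) hG.isUnit_det) k) j
      rwa [Matrix.mul_apply, Matrix.one_apply] at this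
    simp [mul_assoc, ← Finset.mul_sum, h1]
  have hz : ∀ i, G z (stdVec i) = ∑ k, z k * gramOf G k i := by
    intro i
    have := map_eq_sum (G.flip (stdVec i) : Model n →ₗ[ℝ] ℝ) z
    simpa [gramOf] using this
  ext l
  have : (sharpOf G (G z)) l = ∑ i, (gramOf G)⁻¹ i l * G z (stdVec i) := by
    simp [sharpOf, Pi.single_apply, Finset.sum_apply]
  rw [this, ← hH l, Finset.sum_comm]
  refine Finset.sum_congr rfl fun i _ => ?_
  rw [hz, Finset.mul_sum]
  exact Finset.sum_congr rfl fun k _ => by ring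

lemma sharpOf_add (α β : Model n → ℝ) :
    sharpOf G (fun c => α c + β c) = sharpOf G α + sharpOf G β := by
  simp [sharpOf, mul_add, add_smul, Finset.sum_add_distrib]

lemma sharpOf_smul (r : ℝ) (α : Model n → ℝ) :
    sharpOf G (fun c => r * α c) = r • sharpOf G α := by
  simp only [sharpOf, Finset.smul_sum, smul_smul]
  refine Finset.sum_congr rfl fun i _ => Finset.sum_congr rfl fun j _ => ?_
  congr 1
  ring

lemma sharpOf_neg (α : Model n → ℝ) : sharpOf G (fun c => - α c) = - sharpOf G α := by
  simpa using sharpOf_smul (G := G) (-1) α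

lemma sharpOf_sub (α β : Model n → ℝ) :
    sharpOf G (fun c => α c - β c) = sharpOf G α - sharpOf G β := by
  simp only [sub_eq_add_neg]
  rw [sharpOf_add, sharpOf_neg]

lemma IsMetric.map_sharpOf_comm (hG : IsMetric G) (α β : Model n →L[ℝ] ℝ) :
    β (sharpOf G α) = α (sharpOf G β) := by
  rw [← hG.apply_sharpOf β, ← hG.apply_sharpOf α, hG.symm]

section Trace

variable {F F' : Type*} [AddCommGroup F] [Module ℝ F] [AddCommGroup F'] [Module ℝ F']

lemma traceOf_add (B C : Model n → Model n → F) :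
    traceOf G (fun a b => B a b + C a b) = traceOf G B + traceOf G C := by
  simp [traceOf, Finset.sum_add_distrib]

lemma map_traceOf (L : F →ₗ[ℝ] F') (B : Model n → Model n → F) :
    L (traceOf G B) = traceOf G (fun a b => L (B a b)) := by
  simp [traceOf]

lemma traceOf_smul (r : ℝ) (B : Model n → Model n → F) :
    traceOf G (fun a b => r • B a b) = r • traceOf G B := by
  simp only [traceOf, Finset.smul_sum, smul_comm r]

lemma traceOf_neg (B : Model n → Model n → F) :
    traceOf G (fun a b => - B a b) = - traceOf G B := by
  simp [traceOf]

lemma traceOf_sub (B C : Model n → Model n → F) :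
    traceOf G (fun a b => B a b - C a b) = traceOf G B - traceOf G C := by
  simp [traceOf, smul_sub]

lemma IsMetric.traceOf_swap (hG : IsMetric G) (B : Model n → Model n → F) :
    traceOf G (fun a b => B b a) = traceOf G B := by
  unfold traceOf
  rw [Finset.sum_comm]
  exact Finset.sum_congr rfl fun i _ => Finset.sum_congr rfl fun j _ => by rw [hG.inv_symm]

lemma traceOf_sharpOf (B : Model n → Model n → Model n → ℝ) :
    traceOf G (fun a b => sharpOf G (B a b)) = sharpOf G (fun c => traceOf G (fun a b => B a b c)) := by
  -- The dual vector is linear in an arbitrary function, so the trace can be taken in the space of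
  -- functions and then moved through `L`.
  let L : (Model n → ℝ) →ₗ[ℝ] Model n :=
    { toFun := sharpOf G, map_add' := sharpOf_add, map_smul' := sharpOf_smul }
  have h1 : L (traceOf G B) = traceOf G (fun a b => sharpOf G (B a b)) := map_traceOf L B
  have h2 : traceOf G B = fun c => traceOf G (fun a b => B a b c) := by
    ext c
    simp [traceOf, Finset.sum_apply]
  rw [← h1, h2]
  rfl

end Trace

/-- `tr (α ⊗ β) = β (α^♯)`. -/
lemma traceOf_mul (α : Model n → ℝ) (β : Model n →L[ℝ] ℝ) :
    traceOf G (fun a b => α a * β b) = β (sharpOf G α) := by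
  rw [map_sharpOf]
  simp [traceOf, mul_assoc]

/-- Reversing all four indices exchanges the two inverse metrics in a double contraction at once. -/
lemma sum_reverse (f : Fin n → Fin n → Fin n → Fin n → ℝ) :
    ∑ a, ∑ b, ∑ i, ∑ j, f a b i j = ∑ a, ∑ b, ∑ i, ∑ j, f j i b a := by
  simp only [← Fintype.sum_prod_type']
  let e : Fin n × Fin n × Fin n × Fin n ≃ Fin n × Fin n × Fin n × Fin n :=
    ⟨fun p => (p.2.2.2, p.2.2.1, p.2.1, p.1), fun p => (p.2.2.2, p.2.2.1, p.2.1, p.1),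
      fun _ => rfl, fun _ => rfl⟩
  exact Fintype.sum_equiv e (fun p => f p.1 p.2.1 p.2.2.1 p.2.2.2)
    (fun p => f p.2.2.2 p.2.2.1 p.2.1 p.1) fun _ => rfl

lemma map_sharpOf_of_isLinearMap {β : Model n → ℝ} (hβ : IsLinearMap ℝ β) (α : Model n → ℝ) :
    β (sharpOf G α) = ∑ i, ∑ j, (gramOf G)⁻¹ i j * α (stdVec i) * β (stdVec j) :=
  map_sharpOf (LinearMap.toContinuousLinearMap (hβ.mk' β)) α

/-- Both sides contract `X` with the contravariant tensor `g⁻¹ u g⁻¹`, which is symmetric because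
`g` and `u` are. -/
lemma IsMetric.traceOf_sharp_swap (hG : IsMetric G) {X : Model n → Model n → ℝ}
    (hX₁ : ∀ b, IsLinearMap ℝ (fun a => X a b)) (hX₂ : ∀ a, IsLinearMap ℝ (X a))
    (u : Bilin n) (hu : ∀ a b, u a b = u b a) :
    traceOf G (fun a b => X a (sharpOf G (u b))) = traceOf G (fun a b => X (sharpOf G (u b)) a) := by
  have h1 : ∀ a b, X a (sharpOf G (u b)) =
      ∑ i, ∑ j, (gramOf G)⁻¹ i j * u b (stdVec i) * X a (stdVec j) :=
    fun a b => map_sharpOf_of_isLinearMap (hX₂ a) _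
  have h2 : ∀ a b, X (sharpOf G (u b)) a =
      ∑ i, ∑ j, (gramOf G)⁻¹ i j * u b (stdVec i) * X (stdVec j) a :=
    fun a b => map_sharpOf_of_isLinearMap (hX₁ a) _
  simp only [traceOf, h1, h2, smul_eq_mul, Finset.mul_sum]
  rw [sum_reverse]
  refine Finset.sum_congr rfl fun a _ => Finset.sum_congr rfl fun b _ =>
    Finset.sum_congr rfl fun i _ => Finset.sum_congr rfl fun j _ => ?_
  rw [hG.inv_symm j i, hG.inv_symm b a, hu (stdVec i)]
  ring

/-! ### Differentiation of the dual vector and the trace along a curve of metrics -/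

-- The operator norm makes matrices a Banach algebra, where inversion has derivative `B ↦ -A⁻¹ B
-- A⁻¹`. Hypothesis and conclusion are entrywise, so no choice of norm enters the statement.
open scoped Matrix.Norms.Operator in
lemma hasDerivAt_matrix_inv {A : ℝ → Matrix (Fin n) (Fin n) ℝ} {A' : Matrix (Fin n) (Fin n) ℝ}
    {t : ℝ} (hA : ∀ i j, HasDerivAt (fun s => A s i j) (A' i j) t) (hu : IsUnit (A t).det)
    (i j : Fin n) :
    HasDerivAt (fun s => (A s)⁻¹ i j) (-((A t)⁻¹ * A' * (A t)⁻¹) i j) t := by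
  have hM : HasDerivAt A A' t := by
    refine hasDerivAt_pi.2 fun i => hasDerivAt_pi.2 fun j => hA i j
  obtain ⟨U, hU⟩ := (Matrix.isUnit_iff_isUnit_det _).2 hu
  have h1 := hasFDerivAt_ringInverse (𝕜 := ℝ) U
  rw [hU] at h1
  have h2 := h1.comp_hasDerivAt t hM
  have h3 : HasDerivAt (fun s => Ring.inverse (A s) i j) _ t :=
    (hasDerivAt_pi.1 ((hasDerivAt_pi.1 h2) i)) j
  simp only [← Matrix.nonsing_inv_eq_ringInverse] at h3
  convert h3 using 1
  simp [← hU, Matrix.coe_units_inv]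

section Curve

variable {Gs : ℝ → Bilin n} {v : Bilin n}

lemma IsMetric.hasDerivAt_inv_gram (hG : IsMetric (Gs 0))
    (hv : ∀ a b, HasDerivAt (fun s => Gs s a b) (v a b) 0) (i j : Fin n) :
    HasDerivAt (fun s => (gramOf (Gs s))⁻¹ i j)
      (-∑ k, ∑ l, (gramOf (Gs 0))⁻¹ i k * v (stdVec k) (stdVec l) * (gramOf (Gs 0))⁻¹ l j) 0 := by
  have := hasDerivAt_matrix_inv (A := fun s => gramOf (Gs s)) (A' := gramOf v)
    (fun i j => hv _ _) hG.isUnit_det i j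
  convert this using 2
  rw [Matrix.mul_apply, Finset.sum_comm]
  refine Finset.sum_congr rfl fun l _ => ?_
  rw [Matrix.mul_apply, Finset.sum_mul]
  rfl

/-- Differentiating `G(z, ·) = α` gives `G(z', ·) = α' - v(z, ·)`. The computation goes through the
entries of the inverse Gram matrix, which also yields the differentiability of `z`. -/
lemma IsMetric.hasDerivAt_sharpOf (hG : IsMetric (Gs 0))
    (hv : ∀ a b, HasDerivAt (fun s => Gs s a b) (v a b) 0)
    {α : ℝ → Model n → ℝ} {α' : Model n → ℝ} (hα : ∀ b, HasDerivAt (fun s => α s b) (α' b) 0) :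
    HasDerivAt (fun s => sharpOf (Gs s) (α s))
      (sharpOf (Gs 0) (fun c => α' c - v (sharpOf (Gs 0) (α 0)) c)) 0 := by
  have h := HasDerivAt.fun_sum (u := Finset.univ) fun i _ =>
    HasDerivAt.fun_sum (u := Finset.univ) fun j _ =>
    (((hG.hasDerivAt_inv_gram hv i j).mul (hα (stdVec i))).smul_const (stdVec j))
  refine h.congr_deriv ?_
  rw [sharpOf_sub]
  simp only [add_smul, Finset.sum_add_distrib]
  rw [add_comm, sub_eq_add_neg]
  congr 1
  have h2 : ∀ c, v (sharpOf (Gs 0) (α 0)) c =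
      ∑ i, ∑ j, (gramOf (Gs 0))⁻¹ i j * α 0 (stdVec i) * v (stdVec j) c := fun c => by
    simpa using map_sharpOf (G := Gs 0) (v.flip c) (α 0)
  conv_lhs => rw [Finset.sum_comm]
  conv_rhs => rw [sharpOf, Finset.sum_comm]
  rw [← Finset.sum_neg_distrib]
  refine Finset.sum_congr rfl fun j _ => ?_
  rw [← Finset.sum_smul, ← Finset.sum_smul, ← neg_smul]
  congr 1
  simp only [h2, Finset.mul_sum, Finset.sum_mul, neg_mul, Finset.sum_neg_distrib]
  rw [Finset.sum_comm (f := fun b i => ∑ a, (gramOf (Gs 0))⁻¹ b j *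
    ((gramOf (Gs 0))⁻¹ i a * α 0 (stdVec i) * v (stdVec a) (stdVec b)))]
  congr 1
  refine Finset.sum_congr rfl fun i _ => ?_
  rw [Finset.sum_comm]
  exact Finset.sum_congr rfl fun l _ => Finset.sum_congr rfl fun k _ => by ring

/-- The second term is the contraction of `B` with the variation `-g⁻¹ v g⁻¹` of the inverse metric;
linearity of `B 0` in its second slot lets one factor `g⁻¹ v` be moved into that slot. -/
lemma IsMetric.hasDerivAt_traceOf (hG : IsMetric (Gs 0))
    (hv : ∀ a b, HasDerivAt (fun s => Gs s a b) (v a b) 0)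
    {B : ℝ → Model n → Model n → ℝ} {B' : Model n → Model n → ℝ} 
    (hB : ∀ a b, HasDerivAt (fun s => B s a b) (B' a b) 0) (hB₀ : ∀ a, IsLinearMap ℝ (B 0 a)) :
    HasDerivAt (fun s => traceOf (Gs s) (B s))
      (traceOf (Gs 0) B' - traceOf (Gs 0) (fun a b => B 0 a (sharpOf (Gs 0) (v b)))) 0 := by
  have h := HasDerivAt.fun_sum (u := Finset.univ) fun i _ =>
    HasDerivAt.fun_sum (u := Finset.univ) fun j _ =>
    ((hG.hasDerivAt_inv_gram hv i j).mul (hB (stdVec i) (stdVec j)))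
  refine h.congr_deriv ?_
  simp only [Finset.sum_add_distrib]
  rw [add_comm, sub_eq_add_neg]
  congr 1
  have h2 : ∀ a b, B 0 a (sharpOf (Gs 0) (v b)) =
      ∑ i, ∑ j, (gramOf (Gs 0))⁻¹ i j * v b (stdVec i) * B 0 a (stdVec j) :=
    fun a b => map_sharpOf_of_isLinearMap (hB₀ a) _
  simp only [traceOf, h2, smul_eq_mul, Finset.mul_sum, Finset.sum_mul, neg_mul,
    Finset.sum_neg_distrib]
  congr 1
  refine Finset.sum_congr rfl fun i _ => ?_
  rw [Finset.sum_comm]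
  refine Finset.sum_congr rfl fun k _ => ?_
  rw [Finset.sum_comm]
  exact Finset.sum_congr rfl fun l _ => Finset.sum_congr rfl fun j _ => by ring

end Curve

end LinearAlgebra

/-! ### Covariant derivatives at a point, in terms of the first jet -/

section TensorCalculus

variable {n : ℕ}

/-- The Christoffel symbols of the first kind of a metric with first derivative `dG`. -/
def chrisForm (dG : Model n →L[ℝ] Bilin n) (a : Model n) : Bilin n :=
  (1 / 2 : ℝ) • (dG a + dG.flip a - (dG.flip a).flip)

lemma chrisForm_apply (dG : Model n →L[ℝ] Bilin n) (a b c : Model n) :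
    chrisForm dG a b c = (1 / 2 : ℝ) * (dG a b c + dG b a c - dG c a b) := by
  simp [chrisForm]

/-- The Christoffel symbols of a metric `G` with first derivative `dG`. -/
def christoffelOf (G : Bilin n) (dG : Model n →L[ℝ] Bilin n) (a b : Model n) : Model n :=
  sharpOf G (chrisForm dG a b)

/-- The covariant derivative of a bilinear form `u` with first derivative `du`. -/
def nabla2Of (G : Bilin n) (dG : Model n →L[ℝ] Bilin n) (u : Bilin n) (du : Model n →L[ℝ] Bilin n)
    (a b c : Model n) : ℝ :=
  du a b c - u (christoffelOf G dG a b) c - u b (christoffelOf G dG a c)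

/-- The covariant derivative of a covector `α` with first derivative `dα`. -/
def nabla1Of (G : Bilin n) (dG : Model n →L[ℝ] Bilin n) (α : Model n →L[ℝ] ℝ) (dα : Bilin n)
    (a b : Model n) : ℝ :=
  dα a b - α (christoffelOf G dG a b)

variable {G : Bilin n} {dG : Model n →L[ℝ] Bilin n} {u v : Bilin n} {du dv : Model n →L[ℝ] Bilin n}

lemma chrisForm_symm (hdG : ∀ a b c, dG a b c = dG a c b) (a b : Model n) :
    chrisForm dG a b = chrisForm dG b a := by
  ext c
  rw [chrisForm_apply, chrisForm_apply, hdG c a b]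
  ring

lemma christoffelOf_symm (hdG : ∀ a b c, dG a b c = dG a c b) (a b : Model n) :
    christoffelOf G dG a b = christoffelOf G dG b a := by
  rw [christoffelOf, chrisForm_symm hdG, christoffelOf]

/-- This is the metric compatibility `∇g = 0` of the connection, read on Christoffel symbols of the
first kind. -/
lemma chrisForm_add_swap (hdG : ∀ a b c, dG a b c = dG a c b) (a b c : Model n) :
    chrisForm dG a b c + chrisForm dG a c b = dG a b c := by
  rw [chrisForm_apply, chrisForm_apply, hdG a c b]
  ring

lemma christoffelOf_isLinearMap_right (a : Model n) : IsLinearMap ℝ (christoffelOf G dG a) where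
  map_add b c := by
    simp only [christoffelOf, map_add]
    exact sharpOf_add _ _
  map_smul r b := by
    simp only [christoffelOf, map_smul]
    exact sharpOf_smul _ _

lemma christoffelOf_isLinearMap_left (hdG : ∀ a b c, dG a b c = dG a c b) (b : Model n) :
    IsLinearMap ℝ (fun a => christoffelOf G dG a b) := by
  simpa only [christoffelOf_symm hdG _ b] using christoffelOf_isLinearMap_right b

lemma nabla2Of_isLinearMap_first (hdG : ∀ a b c, dG a b c = dG a c b) (b c : Model n) :
    IsLinearMap ℝ (fun a => nabla2Of G dG u du a b c) where
  map_add x y := by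
    simp only [nabla2Of, (christoffelOf_isLinearMap_left hdG _).map_add, map_add,
      add_apply]
    ring
  map_smul r x := by
    simp only [nabla2Of, (christoffelOf_isLinearMap_left hdG _).map_smul, map_smul,
      smul_apply, smul_eq_mul]
    ring

lemma nabla2Of_isLinearMap_second (a c : Model n) :
    IsLinearMap ℝ (fun b => nabla2Of G dG u du a b c) where
  map_add x y := by
    simp only [nabla2Of, (christoffelOf_isLinearMap_right _).map_add, map_add,
      add_apply]
    ring
  map_smul r x := by
    simp only [nabla2Of, (christoffelOf_isLinearMap_right _).map_smul, map_smul,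
      smul_apply, smul_eq_mul]
    ring

lemma nabla2Of_isLinearMap_third (a b : Model n) :
    IsLinearMap ℝ (nabla2Of G dG u du a b) where
  map_add x y := by
    simp only [nabla2Of, (christoffelOf_isLinearMap_right _).map_add, map_add]
    ring
  map_smul r x := by
    simp only [nabla2Of, (christoffelOf_isLinearMap_right _).map_smul, map_smul, smul_eq_mul]
    ring

lemma nabla1Of_isLinearMap (α : Model n →L[ℝ] ℝ) (dα : Bilin n) (a : Model n) :
    IsLinearMap ℝ (nabla1Of G dG α dα a) where
  map_add x y := by
    simp only [nabla1Of, (christoffelOf_isLinearMap_right _).map_add, map_add]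
    ring
  map_smul r x := by
    simp only [nabla1Of, (christoffelOf_isLinearMap_right _).map_smul, map_smul, smul_eq_mul]
    ring

lemma nabla2Of_symm (hu : ∀ a b, u a b = u b a) (hdu : ∀ a b c, du a b c = du a c b)
    (a b c : Model n) : nabla2Of G dG u du a b c = nabla2Of G dG u du a c b := by
  rw [nabla2Of, nabla2Of, hdu a b c, hu b, hu c]
  ring

/-- Raising the index commutes with the covariant derivative of a covector. -/
lemma IsMetric.sharpOf_nabla1Of (hG : IsMetric G) (hdG : ∀ a b c, dG a b c = dG a c b)
    (α : Model n →L[ℝ] ℝ) (dα : Bilin n) (a : Model n) :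
    sharpOf G (fun c => dα a c - dG a (sharpOf G α) c) + christoffelOf G dG a (sharpOf G α)
      = sharpOf G (nabla1Of G dG α dα a) := by
  rw [christoffelOf, ← sharpOf_add]
  congr 1
  funext c
  rw [nabla1Of, christoffelOf, hG.map_sharpOf_comm, ← chrisForm_add_swap hdG]
  ring

/-- Raising an index commutes with the covariant derivative of a bilinear form. -/
lemma IsMetric.sharpOf_nabla2Of (hG : IsMetric G) (hdG : ∀ a b c, dG a b c = dG a c b)
    (a b : Model n) :
    sharpOf G (fun c => dv a b c - dG a (sharpOf G (v b)) c)
      + christoffelOf G dG a (sharpOf G (v b)) - sharpOf G (v (christoffelOf G dG a b))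
      = sharpOf G (nabla2Of G dG v dv a b) := by
  have h := hG.sharpOf_nabla1Of hdG (v b) (dv.flip b) a
  simp only [ContinuousLinearMap.flip_apply] at h
  rw [h, ← sharpOf_sub]
  congr 1
  funext c
  simp only [nabla1Of, nabla2Of, ContinuousLinearMap.flip_apply]
  ring

/-- The trace commutes with the covariant derivative. -/
lemma IsMetric.traceOf_nabla2Of (hG : IsMetric G) (hdG : ∀ a b c, dG a b c = dG a c b)
    (hv : ∀ a b, v a b = v b a) (c : Model n) :
    traceOf G (fun a b => dv c a b) - traceOf G (fun a b => v a (sharpOf G (dG c b)))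
      = traceOf G (nabla2Of G dG v dv c) := by
  have h1 : traceOf G (fun a b => v (christoffelOf G dG c a) b)
      = traceOf G (fun a b => chrisForm dG c a (sharpOf G (v b))) := by
    congr 1; funext a b
    rw [hv, christoffelOf, hG.map_sharpOf_comm]
  have h2 : traceOf G (fun a b => v a (christoffelOf G dG c b))
      = traceOf G (fun a b => chrisForm dG c a (sharpOf G (v b))) := by
    rw [← h1, ← hG.traceOf_swap]
    congr 1; funext a b
    rw [hv]
  have h3 : traceOf G (fun a b => chrisForm dG c a (sharpOf G (v b)))
      = traceOf G (fun a b => chrisForm dG c (sharpOf G (v b)) a) :=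
    hG.traceOf_sharp_swap (X := fun a b => chrisForm dG c a b)
      (fun b => ((chrisForm dG c).flip b : Model n →ₗ[ℝ] ℝ).isLinear)
      (fun a => (chrisForm dG c a : Model n →ₗ[ℝ] ℝ).isLinear) v hv
  -- Metric compatibility splits the term from the inverse metric into two Christoffel contractions,
  -- which match the two correction terms of `nabla2Of`.
  have h4 : traceOf G (fun a b => v a (sharpOf G (dG c b)))
      = traceOf G (fun a b => chrisForm dG c a (sharpOf G (v b)))
        + traceOf G (fun a b => chrisForm dG c (sharpOf G (v b)) a) := by
    rw [← traceOf_add, ← hG.traceOf_swap]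
    congr 1; funext a b
    rw [chrisForm_add_swap hdG, hG.map_sharpOf_comm]
  have h5 : traceOf G (nabla2Of G dG v dv c) = traceOf G (fun a b =>
      dv c a b - v (christoffelOf G dG c a) b - v a (christoffelOf G dG c b)) := rfl
  rw [h5, traceOf_sub, traceOf_sub, h1, h2, h4, ← h3]
  ring

end TensorCalculus

/-! ### First variations at a point -/

section Variation

variable {n : ℕ} {Gs : ℝ → Bilin n} {dGs : ℝ → Model n →L[ℝ] Bilin n} {v : Bilin n}
  {dv : Model n →L[ℝ] Bilin n}

/-- The first variation of the Christoffel symbols of the first kind, as a tensor. -/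
def chrisVar (G : Bilin n) (dG : Model n →L[ℝ] Bilin n) (v : Bilin n) (dv : Model n →L[ℝ] Bilin n)
    (a b c : Model n) : ℝ :=
  (1 / 2 : ℝ) * (nabla2Of G dG v dv a b c + nabla2Of G dG v dv b a c - nabla2Of G dG v dv c a b)

/-- The first jet at a point of a curve of metrics with given velocity. -/
structure IsJetVariation (Gs : ℝ → Bilin n) (dGs : ℝ → Model n →L[ℝ] Bilin n) (v : Bilin n)
    (dv : Model n →L[ℝ] Bilin n) : Prop where
  isMetric : IsMetric (Gs 0)
  symm_jet : ∀ a b c, dGs 0 a b c = dGs 0 a c b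
  symm_velocity : ∀ a b, v a b = v b a
  symm_velocity_jet : ∀ a b c, dv a b c = dv a c b
  hasDerivAt : ∀ a b, HasDerivAt (fun s => Gs s a b) (v a b) 0
  hasDerivAt_jet : ∀ a b c, HasDerivAt (fun s => dGs s a b c) (dv a b c) 0

namespace IsJetVariation

/-- The term `-v(Γ(a,b), c)` coming from the inverse metric is exactly the correction that turns the
partial derivatives of `v` into covariant ones; the other Christoffel terms cancel by symmetry of
`v` and `Γ`. -/
lemma hasDerivAt_christoffelOf (h : IsJetVariation Gs dGs v dv) (a b : Model n) :
    HasDerivAt (fun s => christoffelOf (Gs s) (dGs s) a b)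
      (sharpOf (Gs 0) (chrisVar (Gs 0) (dGs 0) v dv a b)) 0 := by
  have h1 : ∀ c, HasDerivAt (fun s => chrisForm (dGs s) a b c)
      ((1 / 2 : ℝ) * (dv a b c + dv b a c - dv c a b)) 0 := fun c => by
    simp only [chrisForm_apply]
    exact (((h.hasDerivAt_jet a b c).add (h.hasDerivAt_jet b a c)).sub
      (h.hasDerivAt_jet c a b)).const_mul _
  refine (h.isMetric.hasDerivAt_sharpOf h.hasDerivAt h1).congr_deriv ?_
  congr 1
  funext c
  change _ - v (christoffelOf (Gs 0) (dGs 0) a b) c = _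
  simp only [chrisVar, nabla2Of]
  rw [christoffelOf_symm h.symm_jet b a, christoffelOf_symm h.symm_jet c a,
    christoffelOf_symm h.symm_jet c b, h.symm_velocity b (christoffelOf _ _ a c)]
  ring

/-- The trace of the variation of the Levi-Civita connection. -/
lemma traceOf_chrisVar (h : IsJetVariation Gs dGs v dv) :
    traceOf (Gs 0) (fun a b => sharpOf (Gs 0) (chrisVar (Gs 0) (dGs 0) v dv a b))
      = sharpOf (Gs 0) (fun c => traceOf (Gs 0) (fun a b => nabla2Of (Gs 0) (dGs 0) v dv a b c)
        - (1 / 2 : ℝ) * traceOf (Gs 0) (nabla2Of (Gs 0) (dGs 0) v dv c)) := by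
  rw [traceOf_sharpOf]
  congr 1
  funext c
  have h1 : ∀ a b, chrisVar (Gs 0) (dGs 0) v dv a b c
      = (1 / 2 : ℝ) • (nabla2Of (Gs 0) (dGs 0) v dv a b c + nabla2Of (Gs 0) (dGs 0) v dv b a c
        - nabla2Of (Gs 0) (dGs 0) v dv c a b) := fun a b => rfl
  simp only [h1]
  rw [traceOf_smul, traceOf_sub, traceOf_add,
    h.isMetric.traceOf_swap (fun a b => nabla2Of (Gs 0) (dGs 0) v dv a b c), smul_eq_mul]
  change _ * (_ - traceOf (Gs 0) (nabla2Of (Gs 0) (dGs 0) v dv c)) = _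
  ring

/-- Against the symmetric `u`, the first and third terms of `chrisVar` have equal traces by
`IsMetric.traceOf_sharp_swap` and cancel; only the derivative of `v` along `ξ` survives. -/
lemma traceOf_chrisVar_star (h : IsJetVariation Gs dGs v dv) (u : Bilin n)
    (hu : ∀ a b, u a b = u b a) (ξ : Model n) :
    2 * traceOf (Gs 0) (fun a b => u b (sharpOf (Gs 0) (chrisVar (Gs 0) (dGs 0) v dv a ξ)))
      = traceOf (Gs 0) (fun a b => nabla2Of (Gs 0) (dGs 0) v dv ξ (sharpOf (Gs 0) (u a)) b) := by
  set N := nabla2Of (Gs 0) (dGs 0) v dv with hN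
  have hs : ∀ a b c, N a b c = N a c b := nabla2Of_symm h.symm_velocity h.symm_velocity_jet
  have h1 : ∀ a b, u b (sharpOf (Gs 0) (chrisVar (Gs 0) (dGs 0) v dv a ξ))
      = (1 / 2 : ℝ) • (N a ξ (sharpOf (Gs 0) (u b)) + N ξ a (sharpOf (Gs 0) (u b))
        - N (sharpOf (Gs 0) (u b)) ξ a) := fun a b => by
    have hl : IsLinearMap ℝ (chrisVar (Gs 0) (dGs 0) v dv a ξ) := by
      have l1 := nabla2Of_isLinearMap_third (G := Gs 0) (dG := dGs 0) (u := v) (du := dv) a ξ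
      have l2 := nabla2Of_isLinearMap_third (G := Gs 0) (dG := dGs 0) (u := v) (du := dv) ξ a
      have l3 := nabla2Of_isLinearMap_first (G := Gs 0) (u := v) (du := dv) h.symm_jet a ξ
      constructor
      · intro x y
        simp only [chrisVar, l1.map_add, l2.map_add, l3.map_add]
        ring
      · intro r x
        simp only [chrisVar, l1.map_smul, l2.map_smul, l3.map_smul, smul_eq_mul]
        ring
    have := h.isMetric.map_sharpOf_comm (LinearMap.toContinuousLinearMap (hl.mk' _)) (u b)
    refine this.trans ?_
    change chrisVar (Gs 0) (dGs 0) v dv a ξ (sharpOf (Gs 0) (u b)) = _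
    rw [chrisVar, ← hN, hs _ ξ a, smul_eq_mul]
  have h2 : traceOf (Gs 0) (fun a b => N a ξ (sharpOf (Gs 0) (u b)))
      = traceOf (Gs 0) (fun a b => N (sharpOf (Gs 0) (u b)) ξ a) :=
    h.isMetric.traceOf_sharp_swap (X := fun a c => N a ξ c)
      (fun b => nabla2Of_isLinearMap_first h.symm_jet ξ b)
      (fun a => nabla2Of_isLinearMap_third a ξ) u hu
  simp only [h1]
  rw [traceOf_smul, traceOf_sub, traceOf_add, h2, ← h.isMetric.traceOf_swap (fun a b => N ξ _ b)]
  simp only [hs ξ _ (sharpOf _ _), smul_eq_mul]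
  ring

/-- First variation of the weighted divergence of a covector field, on the level of jets. -/
theorem hasDerivAt_weightedDiv (h : IsJetVariation Gs dGs v dv) (α : Model n →L[ℝ] ℝ)
    (dα : Bilin n) {df : ℝ → Model n →L[ℝ] ℝ} {dψ : Model n →L[ℝ] ℝ}
    (hf : ∀ b, HasDerivAt (fun s => df s b)
      ((1 / 2 : ℝ) * traceOf (Gs 0) (nabla2Of (Gs 0) (dGs 0) v dv b) - dψ b) 0) :
    HasDerivAt (fun s => traceOf (Gs s) (nabla1Of (Gs s) (dGs s) α dα)
        - α (sharpOf (Gs s) (df s)))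
      (- traceOf (Gs 0) (fun a b => nabla1Of (Gs 0) (dGs 0) α dα a (sharpOf (Gs 0) (v b)))
        + α (- sharpOf (Gs 0) (fun c =>
              traceOf (Gs 0) (fun a b => nabla2Of (Gs 0) (dGs 0) v dv a b c))
            + sharpOf (Gs 0) (v (sharpOf (Gs 0) (df 0))) + sharpOf (Gs 0) dψ)) 0 := by
  have h1 : ∀ a b, HasDerivAt (fun s => nabla1Of (Gs s) (dGs s) α dα a b)
      (- α (sharpOf (Gs 0) (chrisVar (Gs 0) (dGs 0) v dv a b))) 0 := fun a b =>
    (α.hasFDerivAt.comp_hasDerivAt 0 (h.hasDerivAt_christoffelOf a b)).const_sub _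
  have h2 := h.isMetric.hasDerivAt_traceOf h.hasDerivAt h1 (nabla1Of_isLinearMap α dα)
  have h3 := α.hasFDerivAt.comp_hasDerivAt 0 (h.isMetric.hasDerivAt_sharpOf h.hasDerivAt hf)
  refine (h2.sub h3).congr_deriv ?_
  have h4 := map_traceOf (G := Gs 0) (α : Model n →ₗ[ℝ] ℝ)
    (fun a b => sharpOf (Gs 0) (chrisVar (Gs 0) (dGs 0) v dv a b))
  rw [h.traceOf_chrisVar] at h4
  simp only [ContinuousLinearMap.coe_coe] at h4
  -- The `½ d(tr v)` in the trace of the connection variation now meets the one in the variation of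
  -- `df` with the opposite sign.
  rw [traceOf_neg, ← h4]
  simp only [sharpOf_sub, sharpOf_smul, map_sub, map_add, map_neg]
  ring

/-- First variation of the weighted adjoint of the covariant derivative on symmetric bilinear
forms, on the level of jets. -/
theorem hasDerivAt_weightedAdj2 (h : IsJetVariation Gs dGs v dv) (u : Bilin n)
    (hu : ∀ a b, u a b = u b a)
    (du : Model n →L[ℝ] Bilin n) {df : ℝ → Model n →L[ℝ] ℝ} {dψ : Model n →L[ℝ] ℝ}
    (hf : ∀ b, HasDerivAt (fun s => df s b)
      ((1 / 2 : ℝ) * traceOf (Gs 0) (nabla2Of (Gs 0) (dGs 0) v dv b) - dψ b) 0) (ξ : Model n) :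
    HasDerivAt (fun s => 2 * (- traceOf (Gs s) (fun a b => nabla2Of (Gs s) (dGs s) u du a b ξ)
        + u (sharpOf (Gs s) (df s)) ξ))
      (traceOf (Gs 0) (fun a b => 2 * nabla2Of (Gs 0) (dGs 0) u du a (sharpOf (Gs 0) (v b)) ξ
          + nabla2Of (Gs 0) (dGs 0) v dv ξ (sharpOf (Gs 0) (u a)) b)
        - 2 * u (- sharpOf (Gs 0) (fun c =>
              traceOf (Gs 0) (fun a b => nabla2Of (Gs 0) (dGs 0) v dv a b c))
            + sharpOf (Gs 0) (v (sharpOf (Gs 0) (df 0))) + sharpOf (Gs 0) dψ) ξ) 0 := by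
  have h1 : ∀ a b, HasDerivAt (fun s => nabla2Of (Gs s) (dGs s) u du a b ξ)
      (- u.flip ξ (sharpOf (Gs 0) (chrisVar (Gs 0) (dGs 0) v dv a b))
        - u b (sharpOf (Gs 0) (chrisVar (Gs 0) (dGs 0) v dv a ξ))) 0 := fun a b =>
    (((u.flip ξ).hasFDerivAt.comp_hasDerivAt 0 (h.hasDerivAt_christoffelOf a b)).const_sub _).sub
      ((u b).hasFDerivAt.comp_hasDerivAt 0 (h.hasDerivAt_christoffelOf a ξ))
  have h2 := h.isMetric.hasDerivAt_traceOf h.hasDerivAt h1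
    (fun a => nabla2Of_isLinearMap_second a ξ)
  have h3 := (u.flip ξ).hasFDerivAt.comp_hasDerivAt 0
    (h.isMetric.hasDerivAt_sharpOf h.hasDerivAt hf)
  refine ((h2.neg.add h3).const_mul 2).congr_deriv ?_
  -- The Christoffel symbol in the contracted slot gives a trace as for covectors (`h6`); the one in
  -- the slot of `ξ` gives the second term of `M_g` (`h4`).
  have h4 := h.traceOf_chrisVar_star u hu ξ
  have h5 := traceOf_smul (G := Gs 0) (2 : ℝ)
    (fun a b => nabla2Of (Gs 0) (dGs 0) u du a (sharpOf (Gs 0) (v b)) ξ)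
  simp only [smul_eq_mul] at h5
  have h6 := map_traceOf (G := Gs 0) (u.flip ξ : Model n →ₗ[ℝ] ℝ)
    (fun a b => sharpOf (Gs 0) (chrisVar (Gs 0) (dGs 0) v dv a b))
  rw [h.traceOf_chrisVar] at h6
  simp only [ContinuousLinearMap.coe_coe] at h6
  rw [traceOf_sub, traceOf_neg, ← h6, traceOf_add, h5, ← h4]
  simp only [sharpOf_sub, sharpOf_smul, map_sub, map_add, map_neg, map_smul, smul_eq_mul, ContinuousLinearMap.flip_apply, add_apply,
    neg_apply]
  ring

end IsJetVariation

end Variation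

/-! ### Smooth families over a product with the time axis -/

section Families

open Filter Topology

variable {E F : Type*} [NormedAddCommGroup E] [NormedSpace ℝ E] [NormedAddCommGroup F]
  [NormedSpace ℝ F]

lemma fderiv_slice {Φ : ℝ × E → F} {t : ℝ} {y : E} (h : DifferentiableAt ℝ Φ (t, y)) (a : E) :
    fderiv ℝ (fun y => Φ (t, y)) y a = fderiv ℝ Φ (t, y) (0, a) := by
  have h1 : HasFDerivAt (fun y : E => (t, y)) (ContinuousLinearMap.inr ℝ ℝ E) y :=
    hasFDerivAt_prodMk_right t y
  have h2 : HasFDerivAt (fun y => Φ (t, y)) _ y := h.hasFDerivAt.comp y h1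
  rw [h2.fderiv]
  simp

lemma hasDerivAt_slice {Φ : ℝ × E → F} {t : ℝ} {y : E} (h : DifferentiableAt ℝ Φ (t, y)) :
    HasDerivAt (fun t => Φ (t, y)) (fderiv ℝ Φ (t, y) (1, 0)) t := by
  have h1 : HasFDerivAt (fun t : ℝ => (t, y)) (ContinuousLinearMap.inl ℝ ℝ E) t :=
    hasFDerivAt_prodMk_left t y
  have h2 : HasFDerivAt (fun t => Φ (t, y)) _ t := h.hasFDerivAt.comp t h1
  simpa using h2.hasDerivAt

/-- The time derivative of a `C²` family is differentiable in space, and commutes with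
differentiation in space. -/
lemma hasDerivAt_fderiv_slice {Φ : ℝ × E → F} {φ : E → F} {y₀ : E}
    (hΦ : ContDiffAt ℝ 2 Φ (0, y₀))
    (hφ : ∀ᶠ y in 𝓝 y₀, HasDerivAt (fun t => Φ (t, y)) (φ y) 0) :
    DifferentiableAt ℝ φ y₀ ∧
      ∀ a, HasDerivAt (fun t => fderiv ℝ (fun y => Φ (t, y)) y₀ a) (fderiv ℝ φ y₀ a) 0 := by
  have hev : ∀ᶠ q in 𝓝 ((0 : ℝ), y₀), DifferentiableAt ℝ Φ q :=
    (hΦ.eventually (by simp)).mono fun q hq => hq.differentiableAt (by simp)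
  have hy : ContinuousAt (fun y : E => ((0 : ℝ), y)) y₀ := by fun_prop
  have ht : ContinuousAt (fun t : ℝ => (t, y₀)) 0 := by fun_prop
  -- A priori `φ` is only a pointwise time derivative; it agrees near `y₀` with a partial derivative
  -- of a `C²` map, and this makes it differentiable.
  have hφ' : φ =ᶠ[𝓝 y₀] fun y => fderiv ℝ Φ (0, y) (1, 0) := by
    filter_upwards [hφ, hy.eventually hev] with y h1 h2
    exact h1.unique (hasDerivAt_slice h2)
  have hd : DifferentiableAt ℝ (fderiv ℝ Φ) (0, y₀) :=
    (hΦ.fderiv_right (m := 1) (by norm_num)).differentiableAt (by simp)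
  have h1 : HasFDerivAt (fun y : E => ((0 : ℝ), y)) (ContinuousLinearMap.inr ℝ ℝ E) y₀ :=
    hasFDerivAt_prodMk_right 0 y₀
  have h2 : HasFDerivAt (fun y => fderiv ℝ Φ (0, y) (1, 0)) _ y₀ :=
    ((ContinuousLinearMap.apply ℝ F ((1 : ℝ), (0 : E))).hasFDerivAt.comp y₀
      (hd.hasFDerivAt.comp y₀ h1))
  have h3 := h2.congr_of_eventuallyEq hφ'
  refine ⟨h3.differentiableAt, fun a => ?_⟩
  have h4 : (fun t => fderiv ℝ (fun y => Φ (t, y)) y₀ a) =ᶠ[𝓝 0]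
      fun t => fderiv ℝ Φ (t, y₀) (0, a) := by
    filter_upwards [ht.eventually hev] with t h
    exact fderiv_slice h a
  have h5 := (ContinuousLinearMap.apply ℝ F ((0 : ℝ), a)).hasFDerivAt.comp_hasDerivAt 0
    (hasDerivAt_slice (Φ := fderiv ℝ Φ) hd)
  refine (h5.congr_of_eventuallyEq h4).congr_deriv ?_
  rw [h3.fderiv]
  simpa using (hΦ.isSymmSndFDerivAt (by simp)).eq (1, 0) (0, a)

end Families

/-! ### Determinants and densities -/

section Density

open Filter Topology

/-- Jacobi's formula. In the Leibniz expansion, differentiation replaces one column of `A` at a time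
by that of `A'`; by Cramer's rule the resulting determinant is a diagonal entry of `adjugate * A'`.
-/
lemma hasDerivAt_det {m : Type*} [Fintype m] [DecidableEq m] {A : ℝ → Matrix m m ℝ}
    {A' : Matrix m m ℝ} {t : ℝ} (hA : ∀ i j, HasDerivAt (fun s => A s i j) (A' i j) t) :
    HasDerivAt (fun s => (A s).det) ((A t).adjugate * A').trace t := by
  simp only [Matrix.det_apply']
  have h := HasDerivAt.fun_sum (u := Finset.univ) fun (σ : Equiv.Perm m) _ =>
    (HasDerivAt.fun_finsetProd (u := Finset.univ) fun i _ => hA (σ i) i).const_mul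
      ((Equiv.Perm.sign σ : ℤ) : ℝ)
  refine h.congr_deriv ?_
  have h1 : ∀ k, ((A t).adjugate * A') k k = ((A t).updateCol k (fun i => A' i k)).det := by
    intro k
    rw [← Matrix.cramer_apply, Matrix.cramer_eq_adjugate_mulVec]
    rfl
  simp only [Matrix.trace, Matrix.diag_apply, h1, Matrix.det_apply', Finset.mul_sum]
  rw [Finset.sum_comm]
  refine Finset.sum_congr rfl fun k _ => Finset.sum_congr rfl fun σ _ => ?_
  rw [← Finset.mul_prod_erase Finset.univ _ (Finset.mem_univ k), smul_eq_mul, mul_comm (∏ _ ∈ _, _)]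
  congr 2
  · simp
  · refine Finset.prod_congr rfl fun i hi => ?_
    rw [Matrix.updateCol_ne (Finset.ne_of_mem_erase hi)]

variable {n : ℕ}

/-- The logarithm of the ratio of the Riemannian density of `G` to the density `|w|`. -/
def logDensityOf (G : Bilin n) (w : ℝ) : ℝ := Real.log (Real.sqrt (gramOf G).det / |w|)

/-- Since `Real.log` is `log |·|`, the absolute value disappears and both signs of `w` are treated
at once, leaving an expression that can be differentiated. -/
lemma logDensityOf_eq {G : Bilin n} {w : ℝ} (hG : 0 < (gramOf G).det) (hw : w ≠ 0) :
    logDensityOf G w = (1 / 2 : ℝ) * Real.log (gramOf G).det - Real.log w := by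
  rw [logDensityOf, Real.log_div (Real.sqrt_pos.2 hG).ne' (abs_pos.2 hw).ne', Real.log_abs,
    Real.log_sqrt hG.le]
  ring

lemma hasDerivAt_logDensityOf {Gs : ℝ → Bilin n} {v : Bilin n} {w : ℝ → ℝ} {w' : ℝ}
    (hG : 0 < (gramOf (Gs 0)).det) (hv : ∀ a b, HasDerivAt (fun s => Gs s a b) (v a b) 0)
    (hvs : ∀ a b, v a b = v b a) (hw : HasDerivAt w w' 0) (hw₀ : w 0 ≠ 0) :
    HasDerivAt (fun s => logDensityOf (Gs s) (w s))
      ((1 / 2 : ℝ) * traceOf (Gs 0) (fun a b => v a b) - w' / w 0) 0 := by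
  have h1 := hasDerivAt_det (A := fun s => gramOf (Gs s)) (A' := gramOf v) (t := 0)
    fun i j => hv _ _
  have h2 := ((h1.log hG.ne').const_mul (1 / 2 : ℝ)).sub (hw.log hw₀)
  have h3 : (fun s => logDensityOf (Gs s) (w s)) =ᶠ[𝓝 0]
      fun s => (1 / 2 : ℝ) * Real.log (gramOf (Gs s)).det - Real.log (w s) := by
    filter_upwards [h1.continuousAt.eventually (lt_mem_nhds hG),
      hw.continuousAt.eventually_ne hw₀] with s h4 h5
    exact logDensityOf_eq h4 h5
  refine (h2.congr_of_eventuallyEq h3).congr_deriv ?_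
  congr 2
  rw [traceOf, Matrix.trace, Finset.sum_div]
  refine Finset.sum_congr rfl fun i _ => ?_
  rw [Matrix.diag_apply, Matrix.mul_apply, Finset.sum_div]
  refine Finset.sum_congr rfl fun j _ => ?_
  rw [Matrix.inv_def, Matrix.smul_apply, Ring.inverse_eq_inv', hvs (stdVec i)]
  simp only [gramOf, smul_eq_mul]
  ring

lemma contDiffAt_det {E : Type*} [NormedAddCommGroup E] [NormedSpace ℝ E] {k : WithTop ℕ∞}
    {𝒢 : E → Bilin n} {x : E} (h : ContDiffAt ℝ k 𝒢 x) :
    ContDiffAt ℝ k (fun y => (gramOf (𝒢 y)).det) x := by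
  simp only [Matrix.det_apply', gramOf]
  refine ContDiffAt.sum fun σ _ => contDiffAt_const.mul (contDiffAt_prod fun i _ => ?_)
  exact (h.clm_apply contDiffAt_const).clm_apply contDiffAt_const

lemma contDiffAt_logDensityOf {E : Type*} [NormedAddCommGroup E] [NormedSpace ℝ E]
    {k : WithTop ℕ∞} {𝒢 : E → Bilin n} {w : E → ℝ} {x : E} (h : ContDiffAt ℝ k 𝒢 x)
    (hw : ContDiffAt ℝ k w x) (hG : 0 < (gramOf (𝒢 x)).det) (hw₀ : w x ≠ 0) :
    ContDiffAt ℝ k (fun y => logDensityOf (𝒢 y) (w y)) x := by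
  have h1 := contDiffAt_det h
  have h3 : (fun y => logDensityOf (𝒢 y) (w y)) =ᶠ[𝓝 x]
      fun y => (1 / 2 : ℝ) * Real.log (gramOf (𝒢 y)).det - Real.log (w y) := by
    filter_upwards [h1.continuousAt.eventually (lt_mem_nhds hG),
      hw.continuousAt.eventually_ne hw₀] with s h4 h5
    exact logDensityOf_eq h4 h5
  exact ((contDiffAt_const.mul (h1.log hG.ne')).sub (hw.log hw₀)).congr_of_eventuallyEq h3

end Density

/-! ### Variations of a metric and a density in coordinates -/

section CoordVariation

open Filter Topology

variable {n : ℕ}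

lemma hasDerivAt_bilin_apply {f : ℝ → Bilin n} {f' : Bilin n} {t : ℝ} (h : HasDerivAt f f' t)
    (b c : Model n) : HasDerivAt (fun s => f s b c) (f' b c) t := by
  simpa using (h.clm_apply (hasDerivAt_const t b)).clm_apply (hasDerivAt_const t c)

lemma fderiv_bilin_apply {E : Type*} [NormedAddCommGroup E] [NormedSpace ℝ E]
    {u : E → Bilin n} {y₀ : E} (hu : DifferentiableAt ℝ u y₀) (a : E) (b c : Model n) :
    fderiv ℝ (fun y => u y b c) y₀ a = fderiv ℝ u y₀ a b c := by
  rw [fderiv_clm_apply (hu.clm_apply (differentiableAt_const b)) (differentiableAt_const c),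
    fderiv_clm_apply hu (differentiableAt_const b)]
  simp

/-- A smooth curve of metrics and densities on a neighbourhood of `y₀` in `ℝⁿ`. -/
structure IsCoordVariation (𝒢 : ℝ × Model n → Bilin n) (O : ℝ × Model n → ℝ)
    (v : Model n → Bilin n) (w : Model n → ℝ) (y₀ : Model n) : Prop where
  contDiffAt : ContDiffAt ℝ ∞ 𝒢 (0, y₀)
  contDiffAt_form : ContDiffAt ℝ ∞ O (0, y₀)
  symm : ∀ᶠ y in 𝓝 y₀, ∀ t a b, 𝒢 (t, y) a b = 𝒢 (t, y) b a
  det_pos : 0 < (gramOf (𝒢 (0, y₀))).det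
  form_ne_zero : O (0, y₀) ≠ 0
  velocity : ∀ᶠ y in 𝓝 y₀, ∀ a b, HasDerivAt (fun t => 𝒢 (t, y) a b) (v y a b) 0
  form_velocity : ∀ᶠ y in 𝓝 y₀, HasDerivAt (fun t => O (t, y)) (w y) 0

namespace IsCoordVariation

variable {𝒢 : ℝ × Model n → Bilin n} {O : ℝ × Model n → ℝ} {v : Model n → Bilin n}
  {w : Model n → ℝ} {y₀ : Model n}

lemma symm_velocity (h : IsCoordVariation 𝒢 O v w y₀) :
    ∀ᶠ y in 𝓝 y₀, ∀ a b, v y a b = v y b a := by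
  filter_upwards [h.symm, h.velocity] with y h1 h2 a b
  refine (h2 a b).unique ?_
  simpa only [fun t => h1 t a b] using h2 b a

lemma isMetric (h : IsCoordVariation 𝒢 O v w y₀) : IsMetric (𝒢 (0, y₀)) :=
  ⟨h.symm.self_of_nhds 0, h.det_pos.ne'.isUnit⟩

lemma eventually_hasDerivAt (h : IsCoordVariation 𝒢 O v w y₀) :
    ∀ᶠ y in 𝓝 y₀, HasDerivAt (fun t => 𝒢 (t, y)) (v y) 0 := by
  have hy : ContinuousAt (fun y : Model n => ((0 : ℝ), y)) y₀ := by fun_prop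
  have h1 : ContDiffAt ℝ 1 𝒢 (0, y₀) := h.contDiffAt.of_le (by norm_cast)
  filter_upwards [h.velocity, hy.eventually (h1.eventually (by simp))] with y h1 h2
  have h3 := hasDerivAt_slice (h2.differentiableAt (by simp))
  refine h3.congr_deriv ?_
  ext a b
  refine HasDerivAt.unique ?_ (h1 a b)
  exact hasDerivAt_bilin_apply h3 a b

lemma contDiffAt_two (h : IsCoordVariation 𝒢 O v w y₀) : ContDiffAt ℝ 2 𝒢 (0, y₀) :=
  h.contDiffAt.of_le (by norm_cast)

lemma contDiffAt_form_two (h : IsCoordVariation 𝒢 O v w y₀) : ContDiffAt ℝ 2 O (0, y₀) :=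
  h.contDiffAt_form.of_le (by norm_cast)

lemma differentiableAt_velocity (h : IsCoordVariation 𝒢 O v w y₀) : DifferentiableAt ℝ v y₀ :=
  (hasDerivAt_fderiv_slice h.contDiffAt_two h.eventually_hasDerivAt).1

lemma differentiableAt_form_velocity (h : IsCoordVariation 𝒢 O v w y₀) :
    DifferentiableAt ℝ w y₀ :=
  (hasDerivAt_fderiv_slice h.contDiffAt_form_two h.form_velocity).1

lemma differentiableAt_slice (h : IsCoordVariation 𝒢 O v w y₀) :
    DifferentiableAt ℝ (fun y => 𝒢 (0, y)) y₀ :=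
  (h.contDiffAt_two.differentiableAt (by simp)).comp y₀ (by fun_prop)

lemma differentiableAt_form_slice (h : IsCoordVariation 𝒢 O v w y₀) :
    DifferentiableAt ℝ (fun y => O (0, y)) y₀ :=
  (h.contDiffAt_form_two.differentiableAt (by simp)).comp y₀ (by fun_prop)

end IsCoordVariation

lemma fderiv_symm {u : Model n → Bilin n} {y₀ : Model n} (hu : DifferentiableAt ℝ u y₀)
    (h : ∀ᶠ y in 𝓝 y₀, ∀ a b, u y a b = u y b a) (a b c : Model n) :
    fderiv ℝ u y₀ a b c = fderiv ℝ u y₀ a c b := by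
  rw [← fderiv_bilin_apply hu, ← fderiv_bilin_apply hu]
  have h1 : (fun y => u y b c) =ᶠ[𝓝 y₀] fun y => u y c b := h.mono fun y hy => hy b c
  rw [h1.fderiv_eq]

/-- Reduces a directional derivative to a curve, so that the variation formulas in one real
parameter also compute spatial derivatives. -/
lemma hasDerivAt_line {F : Type*} [NormedAddCommGroup F] [NormedSpace ℝ F] {φ : Model n → F}
    {y₀ : Model n} (h : DifferentiableAt ℝ φ y₀) (a : Model n) :
    HasDerivAt (fun s : ℝ => φ (y₀ + s • a)) (fderiv ℝ φ y₀ a) 0 := by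
  have h1 : HasDerivAt (fun s : ℝ => y₀ + s • a) a 0 := by
    simpa using ((hasDerivAt_id (0 : ℝ)).smul_const a).const_add y₀
  have h2 : HasFDerivAt φ (fderiv ℝ φ y₀) (y₀ + (0 : ℝ) • a) := by simpa using h.hasFDerivAt
  exact h2.comp_hasDerivAt 0 h1

namespace IsCoordVariation

variable {𝒢 : ℝ × Model n → Bilin n} {O : ℝ × Model n → ℝ} {v : Model n → Bilin n}
  {w : Model n → ℝ} {y₀ : Model n}

lemma isJetVariation (h : IsCoordVariation 𝒢 O v w y₀) :
    IsJetVariation (fun t => 𝒢 (t, y₀)) (fun t => fderiv ℝ (fun y => 𝒢 (t, y)) y₀) (v y₀)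
      (fderiv ℝ v y₀) where
  isMetric := h.isMetric
  symm_jet := fderiv_symm h.differentiableAt_slice (h.symm.mono fun _ hy => hy 0)
  symm_velocity := h.symm_velocity.self_of_nhds
  symm_velocity_jet := fderiv_symm h.differentiableAt_velocity h.symm_velocity
  hasDerivAt := h.velocity.self_of_nhds
  hasDerivAt_jet a :=
    hasDerivAt_bilin_apply ((hasDerivAt_fderiv_slice h.contDiffAt_two h.eventually_hasDerivAt).2 a)

/-- In invariant terms `d(tr v) = tr ∇v`: the metrics along the line form a curve to which
`IsMetric.hasDerivAt_traceOf` applies, and `IsMetric.traceOf_nabla2Of` absorbs the derivative of the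
inverse metric. -/
lemma hasDerivAt_traceOf_line (h : IsCoordVariation 𝒢 O v w y₀) (b : Model n) :
    HasDerivAt (fun s : ℝ => traceOf (𝒢 (0, y₀ + s • b)) (fun a c => v (y₀ + s • b) a c))
      (traceOf (𝒢 (0, y₀)) (nabla2Of (𝒢 (0, y₀)) (fderiv ℝ (fun y => 𝒢 (0, y)) y₀)
        (v y₀) (fderiv ℝ v y₀) b)) 0 := by
  have hJ := h.isJetVariation
  have hG' : HasDerivAt (fun s : ℝ => 𝒢 (0, y₀ + s • b)) (fderiv ℝ (fun y => 𝒢 (0, y)) y₀ b) 0 :=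
    hasDerivAt_line (φ := fun y => 𝒢 (0, y)) h.differentiableAt_slice b
  have hG : ∀ a c, HasDerivAt (fun s : ℝ => 𝒢 (0, y₀ + s • b) a c)
      (fderiv ℝ (fun y => 𝒢 (0, y)) y₀ b a c) 0 := hasDerivAt_bilin_apply hG'
  have hv' : HasDerivAt (fun s : ℝ => v (y₀ + s • b)) (fderiv ℝ v y₀ b) 0 :=
    hasDerivAt_line (φ := v) h.differentiableAt_velocity b
  have hv : ∀ a c, HasDerivAt (fun s : ℝ => v (y₀ + s • b) a c) (fderiv ℝ v y₀ b a c) 0 :=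
    hasDerivAt_bilin_apply hv'
  have h0 : y₀ + (0 : ℝ) • b = y₀ := by simp
  have hm : IsMetric (𝒢 (0, y₀ + (0 : ℝ) • b)) := by rw [h0]; exact h.isMetric
  have hl : ∀ a, IsLinearMap ℝ (fun c => v (y₀ + (0 : ℝ) • b) a c) := fun a =>
    ⟨fun _ _ => map_add _ _ _, fun _ _ => map_smul _ _ _⟩
  have h4 := IsMetric.hasDerivAt_traceOf (Gs := fun s : ℝ => 𝒢 (0, y₀ + s • b))
    (v := fderiv ℝ (fun y => 𝒢 (0, y)) y₀ b) (B := fun s a c => v (y₀ + s • b) a c)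
    (B' := fun a c => fderiv ℝ v y₀ b a c) hm hG hv hl
  rw [← h.isMetric.traceOf_nabla2Of hJ.symm_jet hJ.symm_velocity]
  rw [h0] at h4
  exact h4

lemma eventually_hasDerivAt_logDensityOf (h : IsCoordVariation 𝒢 O v w y₀) :
    ∀ᶠ y in 𝓝 y₀, HasDerivAt (fun t => logDensityOf (𝒢 (t, y)) (O (t, y)))
      ((1 / 2 : ℝ) * traceOf (𝒢 (0, y)) (fun a b => v y a b) - w y / O (0, y)) 0 := by
  have hy : ContinuousAt (fun y : Model n => ((0 : ℝ), y)) y₀ := by fun_prop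
  filter_upwards [h.velocity, h.symm_velocity, h.form_velocity,
    h.differentiableAt_form_slice.continuousAt.eventually_ne h.form_ne_zero,
    hy.eventually ((contDiffAt_det h.contDiffAt_two).continuousAt.eventually
      (lt_mem_nhds h.det_pos))] with y k1 k2 k3 k4 k5
  exact hasDerivAt_logDensityOf (Gs := fun t => 𝒢 (t, y)) (w := fun t => O (t, y)) k5 k1 k2 k3 k4

lemma differentiableAt_ratio (h : IsCoordVariation 𝒢 O v w y₀) :
    DifferentiableAt ℝ (fun y => w y / O (0, y)) y₀ := by
  simp only [div_eq_mul_inv]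
  exact h.differentiableAt_form_velocity.fun_mul
    (h.differentiableAt_form_slice.fun_inv h.form_ne_zero)

lemma contDiffAt_logDensityOf (h : IsCoordVariation 𝒢 O v w y₀) :
    ContDiffAt ℝ 2 (fun q => logDensityOf (𝒢 q) (O q)) (0, y₀) :=
  WeightedVariation.contDiffAt_logDensityOf h.contDiffAt_two h.contDiffAt_form_two h.det_pos
    h.form_ne_zero

/-- The first variation of the differential of the log density. -/
lemma hasDerivAt_fderiv_logDensityOf (h : IsCoordVariation 𝒢 O v w y₀) (b : Model n) :
    HasDerivAt (fun t => fderiv ℝ (fun y => logDensityOf (𝒢 (t, y)) (O (t, y))) y₀ b)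
      ((1 / 2 : ℝ) * traceOf (𝒢 (0, y₀)) (nabla2Of (𝒢 (0, y₀)) (fderiv ℝ (fun y => 𝒢 (0, y)) y₀)
        (v y₀) (fderiv ℝ v y₀) b) - fderiv ℝ (fun y => w y / O (0, y)) y₀ b) 0 := by
  have h3 := hasDerivAt_fderiv_slice h.contDiffAt_logDensityOf h.eventually_hasDerivAt_logDensityOf
  refine (h3.2 b).congr_deriv ?_
  -- The time derivative of the log density is `½ tr v - w / O` near `y₀`; its differential is
  -- identified by differentiating along the line in direction `b`.
  exact (hasDerivAt_line h3.1 b).unique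
    (((h.hasDerivAt_traceOf_line b).const_mul _).sub (hasDerivAt_line h.differentiableAt_ratio b))

end IsCoordVariation

end CoordVariation

/-! ### Change of frame -/

section ChangeOfFrame

variable {n : ℕ}

/-- The standard basis of `ℝⁿ`, as a basis. -/
def stdBasis (n : ℕ) : Module.Basis (Fin n) ℝ (Model n) := (EuclideanSpace.basisFun (Fin n) ℝ).toBasis

lemma stdBasis_apply (i : Fin n) : stdBasis n i = stdVec i := by
  simp [stdBasis]

/-- The pullback of a bilinear form by a linear map. -/
abbrev pullBilin (G : Bilin n) (L : Model n →L[ℝ] Model n) : Bilin n := G.bilinearComp L L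

lemma map_stdVec_eq (L : Model n →L[ℝ] Model n) (j : Fin n) :
    L (stdVec j) = ∑ i, LinearMap.toMatrix (stdBasis n) (stdBasis n) L i j • stdVec i := by
  have := (stdBasis n).sum_repr (L (stdVec j))
  simp only [LinearMap.toMatrix_apply, stdBasis_apply] at this ⊢
  exact this.symm

lemma gramOf_pullBilin (G : Bilin n) (L : Model n →L[ℝ] Model n) :
    gramOf (pullBilin G L) = (LinearMap.toMatrix (stdBasis n) (stdBasis n) L).transpose * gramOf G *
      LinearMap.toMatrix (stdBasis n) (stdBasis n) L := by
  ext i j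
  simp only [gramOf, pullBilin, ContinuousLinearMap.bilinearComp_apply, Matrix.mul_apply,
    Matrix.transpose_apply]
  rw [map_stdVec_eq L i, map_stdVec_eq L j]
  simp only [map_sum, map_smul, sum_apply, smul_apply, smul_eq_mul,
    Finset.sum_mul, Finset.mul_sum]
  exact Finset.sum_congr rfl fun k _ => Finset.sum_congr rfl fun l _ => by ring

lemma det_gramOf_pullBilin (G : Bilin n) (L : Model n →L[ℝ] Model n) :
    (gramOf (pullBilin G L)).det
      = LinearMap.det (L : Model n →ₗ[ℝ] Model n) ^ 2 * (gramOf G).det := by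
  rw [gramOf_pullBilin, Matrix.det_mul, Matrix.det_mul, Matrix.det_transpose,
    LinearMap.det_toMatrix]
  ring

lemma alternatingMap_comp_frame (θ : (Model n) [⋀^Fin n]→ₗ[ℝ] ℝ) (L : Model n →L[ℝ] Model n) :
    θ (fun i => L (stdVec i)) = LinearMap.det (L : Model n →ₗ[ℝ] Model n) * θ stdVec := by
  have h1 := DFunLike.congr_fun (AlternatingMap.eq_smul_basis_det (stdBasis n) θ)
    (fun i => L (stdVec i))
  have h2 : (stdBasis n : Fin n → Model n) = stdVec := funext stdBasis_apply
  rw [h1, AlternatingMap.smul_apply, h2, smul_eq_mul, mul_comm]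
  congr 1
  rw [← h2]
  exact Module.Basis.det_comp_basis (stdBasis n) (stdBasis n) (L : Model n →ₗ[ℝ] Model n) |>.trans
    (by simp)

lemma det_ne_zero_of_isInvertible {L : Model n →L[ℝ] Model n} (hL : L.IsInvertible) :
    LinearMap.det (L : Model n →ₗ[ℝ] Model n) ≠ 0 := by
  obtain ⟨e, rfl⟩ := hL
  exact (LinearEquiv.isUnit_det' e.toLinearEquiv).ne_zero

/-- Both densities scale by `|det L|`, so their ratio is independent of the frame and `f` may be
computed in any chart. -/
lemma logDensityOf_pullBilin (G : Bilin n) (θ : (Model n) [⋀^Fin n]→ₗ[ℝ] ℝ)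
    {L : Model n →L[ℝ] Model n} (hL : L.IsInvertible) :
    logDensityOf (pullBilin G L) (θ fun i => L (stdVec i)) = logDensityOf G (θ stdVec) := by
  have hd := det_ne_zero_of_isInvertible hL
  rw [logDensityOf, logDensityOf, det_gramOf_pullBilin, alternatingMap_comp_frame,
    Real.sqrt_mul (sq_nonneg _), Real.sqrt_sq_eq_abs, abs_mul,
    mul_div_mul_left _ _ (abs_pos.2 hd).ne']

lemma IsMetric.pullBilin {G : Bilin n} (hG : IsMetric G) {L : Model n →L[ℝ] Model n}
    (hL : L.IsInvertible) : IsMetric (pullBilin G L) where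
  symm a b := hG.symm _ _
  isUnit_det := by
    rw [det_gramOf_pullBilin]
    exact ((det_ne_zero_of_isInvertible hL).isUnit.pow 2).mul hG.isUnit_det

lemma IsMetric.inverse_sharpOf {G : Bilin n} (hG : IsMetric G) {L : Model n →L[ℝ] Model n}
    (hL : L.IsInvertible) (β : Model n →L[ℝ] ℝ) :
    L.inverse (sharpOf G β) = sharpOf (WeightedVariation.pullBilin G L) (fun c => β (L c)) := by
  refine (hG.pullBilin hL).eq_sharpOf fun b => ?_
  rw [ContinuousLinearMap.bilinearComp_apply]
  have : L (L.inverse (sharpOf G β)) = sharpOf G β := by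
    obtain ⟨e, rfl⟩ := hL
    simp
  rw [this, hG.apply_sharpOf]

lemma posDef_det_pos {G : Bilin n} (hs : ∀ a b, G a b = G b a) (hp : ∀ a, a ≠ 0 → 0 < G a a) :
    0 < (gramOf G).det := by
  refine Matrix.PosDef.det_pos (Matrix.PosDef.of_dotProduct_mulVec_pos ?_ fun x hx => ?_)
  · ext i j
    simp [gramOf, Matrix.conjTranspose_apply, hs (stdVec j)]
  · have h1 : (∑ i, x i • stdVec i : Model n) ≠ 0 := by
      intro h0
      apply hx
      have := sum_smul_stdVec (WithLp.toLp 2 x : Model n)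
      simp only at this
      rw [h0] at this
      ext i
      simpa using (congrArg (fun z : Model n => z i) this).symm
    have h2 := hp _ h1
    simp only [map_sum, map_smul, sum_apply, smul_apply, smul_eq_mul] at h2
    simp only [dotProduct, Matrix.mulVec, gramOf, Finset.mul_sum]
    refine h2.trans_eq ?_
    rw [Finset.sum_comm]
    simp only [Finset.mul_sum]
    exact Finset.sum_congr rfl fun k _ => Finset.sum_congr rfl fun l _ => by
      simp; ring

end ChangeOfFrame

/-! ### Differentiability of dual vectors and of maps into spaces of linear maps -/

section Smoothness

variable {n : ℕ} {D F : Type*} [NormedAddCommGroup D] [NormedSpace ℝ D] [NormedAddCommGroup F]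
  [NormedSpace ℝ F]

/-- In finite dimension `f` is a sum of fixed coordinate projections times its values on basis
vectors. This passes from the smoothness of components to that of the tensor-valued map. -/
lemma contDiffAt_of_apply {k : WithTop ℕ∞} {f : D → Model n →L[ℝ] F} {x : D}
    (h : ∀ b, ContDiffAt ℝ k (fun y => f y b) x) : ContDiffAt ℝ k f x := by
  have h1 : f = fun y => ∑ i, ContinuousLinearMap.smulRight
      (EuclideanSpace.proj i : Model n →L[ℝ] ℝ) (f y (stdVec i)) := by
    funext y
    ext b
    simpa using map_eq_sum (f y : Model n →ₗ[ℝ] F) b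
  rw [h1]
  exact ContDiffAt.sum fun i _ => contDiffAt_const.smulRight (h _)

open scoped Matrix.Norms.Operator in
lemma differentiableAt_matrix_inv {A : D → Matrix (Fin n) (Fin n) ℝ} {x : D}
    (hA : ∀ i j, DifferentiableAt ℝ (fun y => A y i j) x) (hu : IsUnit (A x).det) (i j : Fin n) :
    DifferentiableAt ℝ (fun y => (A y)⁻¹ i j) x := by
  have hM : DifferentiableAt ℝ A x := differentiableAt_pi.2 fun i => differentiableAt_pi.2 (hA i)
  have h1 := differentiableAt_inverse (𝕜 := ℝ) ((Matrix.isUnit_iff_isUnit_det _).2 hu)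
  have h3 : DifferentiableAt ℝ (fun y => Ring.inverse (A y) i j) x :=
    (differentiableAt_pi.1 ((differentiableAt_pi.1 (h1.comp x hM)) i)) j
  simpa only [← Matrix.nonsing_inv_eq_ringInverse] using h3

lemma differentiableAt_sharpOf {𝒢 : D → Bilin n} {α : D → Model n →L[ℝ] ℝ} {x : D}
    (h𝒢 : DifferentiableAt ℝ 𝒢 x) (hα : DifferentiableAt ℝ α x) (hG : IsMetric (𝒢 x)) :
    DifferentiableAt ℝ (fun y => sharpOf (𝒢 y) (α y)) x := by
  unfold sharpOf
  refine DifferentiableAt.fun_sum fun i _ => DifferentiableAt.fun_sum fun j _ => ?_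
  have h1 : DifferentiableAt ℝ (fun y => (gramOf (𝒢 y))⁻¹ i j) x :=
    differentiableAt_matrix_inv (A := fun y => gramOf (𝒢 y)) (fun k l =>
      (h𝒢.clm_apply (differentiableAt_const _)).clm_apply (differentiableAt_const _))
      hG.isUnit_det i j
  exact (h1.fun_mul (hα.clm_apply (differentiableAt_const _))).smul_const _

/-- The derivative of the dual vector field of a covector field. -/
lemma fderiv_sharpOf {𝒢 : Model n → Bilin n} {α : Model n → Model n →L[ℝ] ℝ} {y₀ : Model n}
    (h𝒢 : DifferentiableAt ℝ 𝒢 y₀) (hα : DifferentiableAt ℝ α y₀) (hG : IsMetric (𝒢 y₀))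
    (a : Model n) :
    fderiv ℝ (fun y => sharpOf (𝒢 y) (α y)) y₀ a = sharpOf (𝒢 y₀) (fun c =>
      fderiv ℝ α y₀ a c - fderiv ℝ 𝒢 y₀ a (sharpOf (𝒢 y₀) (α y₀)) c) := by
  have h0 : y₀ + (0 : ℝ) • a = y₀ := by simp
  have hm : IsMetric (𝒢 (y₀ + (0 : ℝ) • a)) := by rw [h0]; exact hG
  have h1 : HasDerivAt (fun s : ℝ => 𝒢 (y₀ + s • a)) (fderiv ℝ 𝒢 y₀ a) 0 :=
    hasDerivAt_line (φ := 𝒢) h𝒢 a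
  have h2 : HasDerivAt (fun s : ℝ => α (y₀ + s • a)) (fderiv ℝ α y₀ a) 0 :=
    hasDerivAt_line (φ := α) hα a
  have h3 : ∀ b, HasDerivAt (fun s : ℝ => α (y₀ + s • a) b) (fderiv ℝ α y₀ a b) 0 := fun b => by
    simpa using h2.clm_apply (hasDerivAt_const 0 b)
  have h4 := IsMetric.hasDerivAt_sharpOf (Gs := fun s : ℝ => 𝒢 (y₀ + s • a))
    (v := fderiv ℝ 𝒢 y₀ a) (α := fun s b => α (y₀ + s • a) b) (α' := fun b => fderiv ℝ α y₀ a b)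
    hm (hasDerivAt_bilin_apply h1) h3
  rw [h0] at h4
  exact (hasDerivAt_line (φ := fun y => sharpOf (𝒢 y) (α y))
    (differentiableAt_sharpOf h𝒢 hα hG) a).unique h4

end Smoothness

/-! ### Tensors in the chart around a point -/

section Coordinates

open Filter Topology

variable {n : ℕ} {X : Type*} [TopologicalSpace X] [ChartedSpace (Model n) X]

/-- The coordinates of the base point of the chart around `p`. -/
abbrev basePt (n : ℕ) {X : Type*} [TopologicalSpace X] [ChartedSpace (Model n) X] (p : X) : Model n := extChartAt (𝓡 n) p p

/-- The inverse of the chart around `p`. -/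
abbrev chartInv (n : ℕ) {X : Type*} [TopologicalSpace X] [ChartedSpace (Model n) X] (p : X) (y : Model n) : X := (extChartAt (𝓡 n) p).symm y

lemma chartInv_basePt (p : X) : chartInv n p (basePt n p) = p := extChartAt_to_inv p

lemma target_mem_nhds (p : X) : ∀ᶠ y in 𝓝 (basePt n p), y ∈ (extChartAt (𝓡 n) p).target :=
  extChartAt_target_mem_nhds p

/-- The coordinate frame, as an endomorphism of the model space. -/
def frame (p : X) (y : Model n) : Model n →L[ℝ] Model n := coordFrame p y

/-- A covariant `2`-tensor at a point as a bilinear form on the model space. -/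
def tensorAt (u : Tensor2 n X) (x : X) : Bilin n := u x

/-- A `1`-form at a point as a covector on the model space. -/
def covectorAt (α : OneForm n X) (x : X) : Model n →L[ℝ] ℝ := α x

/-- A top degree form at a point as an alternating form on the model space. -/
def topFormAt (Ω : TopForm n X) (x : X) : (Model n) [⋀^Fin n]→ₗ[ℝ] ℝ := Ω x

/-- The components of a covariant `2`-tensor in the chart around `p`. -/
def coord2 (p : X) (u : Tensor2 n X) (y : Model n) : Bilin n :=
  pullBilin (tensorAt u (chartInv n p y)) (frame p y)

/-- The components of a `1`-form in the chart around `p`. -/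
def coord1 (p : X) (α : OneForm n X) (y : Model n) : Model n →L[ℝ] ℝ :=
  (covectorAt α (chartInv n p y)).comp (frame p y)

lemma coordTop_eq (p : X) (Ω : TopForm n X) (y : Model n) :
    coordTop p Ω y = topFormAt Ω (chartInv n p y) (fun i => frame p y (stdVec i)) := rfl

lemma coord2_apply (p : X) (u : Tensor2 n X) (y b c : Model n) :
    coord2 p u y b c = u (chartInv n p y) (coordFrame p y b) (coordFrame p y c) :=
  ContinuousLinearMap.bilinearComp_apply _ _ _ _ _

lemma frame_eq_symmL [IsManifold (𝓡 n) 1 X] (p : X) {x : X} (hx : x ∈ (chartAt (Model n) p).source) :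
    frame p (extChartAt (𝓡 n) p x)
      = (trivializationAt (Model n) (TangentSpace (𝓡 n)) p).symmL ℝ x := by
  have h := TangentBundle.symmL_trivializationAt (𝕜 := ℝ) (I := 𝓡 n) hx
  rw [ModelWithCorners.range_eq_univ, mfderivWithin_univ] at h
  exact h.symm

variable [IsManifold (𝓡 n) ∞ X]

lemma frame_isInvertible (p : X) {y : Model n} (hy : y ∈ (extChartAt (𝓡 n) p).target) :
    (frame p y).IsInvertible := by
  have : IsManifold (𝓡 n) 1 X := IsManifold.of_le (n := ∞) (by norm_cast)
  have h := isInvertible_mfderivWithin_extChartAt_symm (I := 𝓡 n) hy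
  rw [ModelWithCorners.range_eq_univ, mfderivWithin_univ] at h
  exact h

/-- The fibre at `p` is identified with `ℝⁿ` through the preferred chart at `p`, so here the frame
is the coordinate change of that chart with itself. -/
lemma frame_basePt (p : X) : frame p (basePt n p) = ContinuousLinearMap.id ℝ (Model n) := by
  have : IsManifold (𝓡 n) 1 X := IsManifold.of_le (n := ∞) (by norm_cast)
  have hx := mem_chart_source (Model n) p
  have h := TangentBundle.symmL_trivializationAt_eq_core (𝕜 := ℝ) (I := 𝓡 n) hx
  ext1 a
  have h2 : frame p (basePt n p) a
      = (tangentBundleCore (𝓡 n) X).coordChange (achart (Model n) p) (achart (Model n) p) p a :=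
    (DFunLike.congr_fun (frame_eq_symmL p hx) a).trans (DFunLike.congr_fun h a)
  rw [h2]
  exact (tangentBundleCore (𝓡 n) X).coordChange_self _ _ hx a

lemma coord2_basePt (p : X) (u : Tensor2 n X) : coord2 p u (basePt n p) = tensorAt u p := by
  rw [coord2, frame_basePt, chartInv_basePt]
  rfl

lemma coord1_basePt (p : X) (α : OneForm n X) : coord1 p α (basePt n p) = covectorAt α p := by
  rw [coord1, frame_basePt, chartInv_basePt]
  rfl

lemma logDensity_chartInv (p : X) (g : Metric n X) (Ω : TopForm n X) {y : Model n}
    (hy : y ∈ (extChartAt (𝓡 n) p).target) :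
    logDensity g Ω (chartInv n p y) = logDensityOf (coord2 p g.inner y) (coordTop p Ω y) :=
  (logDensityOf_pullBilin (tensorAt g.inner (chartInv n p y)) (topFormAt Ω (chartInv n p y))
    (frame_isInvertible p hy)).symm

lemma ratio_chartInv (p : X) (V Ω : TopForm n X) {y : Model n}
    (hy : y ∈ (extChartAt (𝓡 n) p).target) :
    V.ratio Ω (chartInv n p y) = coordTop p V y / coordTop p Ω y := by
  rw [coordTop_eq, coordTop_eq, alternatingMap_comp_frame, alternatingMap_comp_frame,
    mul_div_mul_left _ _ (det_ne_zero_of_isInvertible (frame_isInvertible p hy))]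
  rfl

lemma isMetric_inner (g : Metric n X) (x : X) : IsMetric (tensorAt g.inner x) :=
  ⟨g.symm x, (posDef_det_pos (g.symm x) (g.pos x)).ne'.isUnit⟩

lemma contMDiffAt_chartInv (p : X) :
    ContMDiffAt 𝓘(ℝ, Model n) (𝓡 n) ∞ (chartInv n p) (basePt n p) :=
  (contMDiffOn_extChartAt_symm p).contMDiffAt (extChartAt_target_mem_nhds p)

variable {W : Type*} [NormedAddCommGroup W] [NormedSpace ℝ W]

/-- In the trivialization at `p` the frame vector has the constant coordinate `b`. The parameter `τ`
covers both fixed tensors (`W = ℝⁿ`) and curves of metrics (`W = ℝ × ℝⁿ`). -/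
lemma contMDiffAt_frame (p : X) {τ : W → Model n} {w₀ : W} (hτ : ContDiffAt ℝ ∞ τ w₀)
    (hw : τ w₀ = basePt n p) (b : Model n) :
    ContMDiffAt 𝓘(ℝ, W) ((𝓡 n).prod 𝓘(ℝ, Model n)) ∞
      (fun w => Bundle.TotalSpace.mk' (E := fun x : X => TangentSpace (𝓡 n) x) (Model n)
        (chartInv n p (τ w)) (coordFrame p (τ w) b)) w₀ := by
  have : IsManifold (𝓡 n) 1 X := IsManifold.of_le (n := ∞) (by norm_cast)
  have hc : ContMDiffAt 𝓘(ℝ, W) (𝓡 n) ∞ (fun w => chartInv n p (τ w)) w₀ := by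
    have h1 := contMDiffAt_chartInv (n := n) p
    rw [← hw] at h1
    exact h1.comp w₀ hτ.contMDiffAt
  have h0 : chartInv n p (τ w₀) ∈ (chartAt (Model n) p).source := by
    rw [hw, chartInv_basePt]
    exact mem_chart_source _ p
  have hs : ∀ᶠ w in 𝓝 w₀, τ w ∈ (extChartAt (𝓡 n) p).target := by
    refine hτ.continuousAt.eventually ?_
    rw [hw]
    exact target_mem_nhds p
  rw [Bundle.Trivialization.contMDiffAt_iff
    (e := trivializationAt (Model n) (TangentSpace (𝓡 n)) p)]
  · refine ⟨hc, ?_⟩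
    refine (contMDiffAt_const (c := b)).congr_of_eventuallyEq ?_
    filter_upwards [hs] with w hw'
    have hx : chartInv n p (τ w) ∈ (chartAt (Model n) p).source := by
      have := (extChartAt (𝓡 n) p).map_target hw'
      rwa [extChartAt_source] at this
    have h1 := frame_eq_symmL p hx
    rw [(extChartAt (𝓡 n) p).right_inv hw'] at h1
    have h2 : coordFrame p (τ w) b
        = (trivializationAt (Model n) (TangentSpace (𝓡 n)) p).symmL ℝ (chartInv n p (τ w)) b :=
      DFunLike.congr_fun h1 b
    have hb : chartInv n p (τ w) ∈
        (trivializationAt (Model n) (TangentSpace (𝓡 n)) p).baseSet := hx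
    rw [h2, Bundle.Trivialization.symmL_apply _ hb]
    exact congrArg Prod.snd (Bundle.Trivialization.apply_mk_symm _ hb b)
  · rw [Bundle.Trivialization.mem_source]
    exact h0

lemma contDiffAt_coord2_apply (p : X) {τ : W → Model n} {w₀ : W} (hτ : ContDiffAt ℝ ∞ τ w₀)
    (hw : τ w₀ = basePt n p)
    {ψ : (w : W) → TangentSpace (𝓡 n) (chartInv n p (τ w)) →L[ℝ]
      TangentSpace (𝓡 n) (chartInv n p (τ w)) →L[ℝ] ℝ}
    (hψ : ContMDiffAt 𝓘(ℝ, W) ((𝓡 n).prod 𝓘(ℝ, Model n →L[ℝ] Model n →L[ℝ] ℝ)) ∞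
      (fun w => Bundle.TotalSpace.mk'
        (E := fun x : X => TangentSpace (𝓡 n) x →L[ℝ] TangentSpace (𝓡 n) x →L[ℝ] ℝ)
        (Model n →L[ℝ] Model n →L[ℝ] ℝ) (chartInv n p (τ w)) (ψ w)) w₀) (b c : Model n) :
    ContDiffAt ℝ ∞ (fun w => ψ w (coordFrame p (τ w) b) (coordFrame p (τ w) c)) w₀ := by
  have h := ContMDiffAt.clm_bundle_apply₂ (F₁ := Model n) (F₂ := Model n) (F₃ := ℝ)
    (E₃ := Bundle.Trivial X ℝ) hψ (contMDiffAt_frame p hτ hw b) (contMDiffAt_frame p hτ hw c)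
  rw [Bundle.contMDiffAt_totalSpace] at h
  have h2 := h.2
  simp only [Bundle.Trivial.fiberBundle_trivializationAt', Bundle.Trivial.trivialization_apply] at h2
  exact h2.contDiffAt

lemma contDiffAt_coord1_apply (p : X) {α : OneForm n X} (hα : α.Smooth) (b : Model n) :
    ContDiffAt ℝ ∞ (fun y => coord1 p α y b) (basePt n p) := by
  have h1 : ContMDiffAt 𝓘(ℝ, Model n) ((𝓡 n).prod 𝓘(ℝ, Model n →L[ℝ] ℝ)) ∞
      (fun y => Bundle.TotalSpace.mk' (E := fun x : X => TangentSpace (𝓡 n) x →L[ℝ] ℝ)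
      (Model n →L[ℝ] ℝ) (chartInv n p y) (α (chartInv n p y))) (basePt n p) :=
    (hα _).comp (basePt n p) (contMDiffAt_chartInv p)
  have h := ContMDiffAt.clm_bundle_apply (F₁ := Model n) (F₂ := ℝ)
    (E₂ := Bundle.Trivial X ℝ) h1 (contMDiffAt_frame p contDiffAt_id rfl b)
  rw [Bundle.contMDiffAt_totalSpace] at h
  have h2 := h.2
  simp only [Bundle.Trivial.fiberBundle_trivializationAt', Bundle.Trivial.trivialization_apply] at h2
  exact h2.contDiffAt

lemma contDiffAt_coord1 (p : X) {α : OneForm n X} (hα : α.Smooth) :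
    ContDiffAt ℝ ∞ (coord1 p α) (basePt n p) :=
  contDiffAt_of_apply fun b => contDiffAt_coord1_apply p hα b

lemma contDiffAt_coord2 (p : X) {u : Tensor2 n X} (hu : u.Smooth) :
    ContDiffAt ℝ ∞ (coord2 p u) (basePt n p) :=
  contDiffAt_of_apply fun b => contDiffAt_of_apply fun c =>
    contDiffAt_coord2_apply p (ψ := fun y => u (chartInv n p y)) contDiffAt_id rfl
      ((hu _).comp (basePt n p) (contMDiffAt_chartInv p)) b c

end Coordinates

/-! ### From a variation on the manifold to a variation in a chart -/

section CoordinateVariation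

open Filter Topology

variable {n : ℕ} {X : Type*} [TopologicalSpace X] [ChartedSpace (Model n) X]
  [IsManifold (𝓡 n) ∞ X]

lemma IsVariation.symm_velocity {g : ℝ → Metric n X} {Ω : ℝ → TopForm n X} {v : Tensor2 n X}
    {V : TopForm n X} (h : IsVariation g Ω v V) : v.Symmetric := by
  intro x a b
  refine (h.metric_velocity x a b).unique ?_
  simpa only [fun t => (g t).symm x a b] using h.metric_velocity x b a

/-- A smooth variation is smooth in every chart. -/
lemma IsVariation.isCoordVariation {g : ℝ → Metric n X} {Ω : ℝ → TopForm n X} {v : Tensor2 n X}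
    {V : TopForm n X} (h : IsVariation g Ω v V) (p : X) :
    IsCoordVariation (fun q => coord2 p (g q.1).inner q.2) (fun q => coordTop p (Ω q.1) q.2)
      (coord2 p v) (coordTop p V) (basePt n p) := by
  obtain ⟨ε, hε, h1, h2, h3⟩ := h.smooth
  have h0 : Set.Ioo (-ε) ε ∈ 𝓝 (0 : ℝ) := Ioo_mem_nhds (by linarith) hε
  refine ⟨?_, ?_, ?_, ?_, ?_, ?_, ?_⟩
  · have hm : ContMDiffAt 𝓘(ℝ, ℝ × Model n) (𝓘(ℝ, ℝ).prod (𝓡 n)) ∞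
        (fun q : ℝ × Model n => (q.1, chartInv n p q.2)) (0, basePt n p) := by
      refine ContMDiffAt.prodMk ?_ ?_
      · exact contDiffAt_fst.contMDiffAt
      · exact (contMDiffAt_chartInv p).comp ((0 : ℝ), basePt n p)
          (contDiffAt_snd (𝕜 := ℝ) (E := ℝ) (F := Model n)).contMDiffAt
    have hg := (h1 (0, chartInv n p (basePt n p)) ⟨⟨by simpa using hε, hε⟩, trivial⟩).contMDiffAt
      (prod_mem_nhds h0 univ_mem)
    exact contDiffAt_of_apply fun b => contDiffAt_of_apply fun c =>
      contDiffAt_coord2_apply p (W := ℝ × Model n) (τ := Prod.snd) (w₀ := (0, basePt n p))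
        (ψ := fun q => (g q.1).inner (chartInv n p q.2)) contDiffAt_snd rfl
        (ContMDiffAt.comp (0, basePt n p) hg hm) b c
  · exact (h2 p).contDiffAt (prod_mem_nhds h0 (extChartAt_target_mem_nhds p))
  · exact Eventually.of_forall fun y t a b => (g t).symm _ _ _
  · simp only [coord2_basePt]
    exact posDef_det_pos ((g 0).symm p) ((g 0).pos p)
  · simp only [coordTop_eq, frame_basePt]
    intro h4
    refine h3 0 ⟨by linarith, hε⟩ (chartInv n p (basePt n p)) ?_
    -- A top degree form is its value on a basis times the determinant, so a zero component would
    -- force the form to vanish at `p`.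
    have h5 := AlternatingMap.eq_smul_basis_det (stdBasis n) (topFormAt (Ω 0) (chartInv n p (basePt n p)))
    rw [funext stdBasis_apply] at h5
    have h6 : topFormAt (Ω 0) (chartInv n p (basePt n p)) stdVec = 0 := h4
    rw [h6, zero_smul] at h5
    exact h5
  · refine Eventually.of_forall fun y a b => ?_
    simp only [coord2_apply]
    exact h.metric_velocity _ _ _
  · exact Eventually.of_forall fun y =>
      h.form_velocity (chartInv n p y) (fun i => coordFrame p y (stdVec i))

end CoordinateVariation

/-! ### The operators of a metric in terms of coordinates -/

section Operators

open Filter Topology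

lemma hasFDerivAt_smul {D F : Type*} [NormedAddCommGroup D] [NormedSpace ℝ D]
    [NormedAddCommGroup F] [NormedSpace ℝ F] {c : D → ℝ} {f : D → F} {x : D}
    (hc : DifferentiableAt ℝ c x) (hf : DifferentiableAt ℝ f x) :
    HasFDerivAt (fun y => c y • f y) (c x • fderiv ℝ f x + (fderiv ℝ c x).smulRight (f x)) x :=
  hc.hasFDerivAt.fun_smul hf.hasFDerivAt

variable {n : ℕ} {X : Type*} [TopologicalSpace X] [ChartedSpace (Model n) X]

/-- The first derivative at `p` of the components of a covariant `2`-tensor. -/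
abbrev jet2 (p : X) (u : Tensor2 n X) : Model n →L[ℝ] Bilin n := fderiv ℝ (coord2 p u) (basePt n p)

/-- The first derivative at `p` of the components of a `1`-form. -/
abbrev jet1 (p : X) (α : OneForm n X) : Bilin n := fderiv ℝ (coord1 p α) (basePt n p)

/-- The differential at `p` of a function in the chart around `p`. -/
abbrev jet0 (p : X) (φ : X → ℝ) : Model n →L[ℝ] ℝ :=
  fderiv ℝ (fun y => φ (chartInv n p y)) (basePt n p)

variable {p : X} {u v : Tensor2 n X} {α : OneForm n X} {φ : X → ℝ}

lemma partial2_eq (hu : DifferentiableAt ℝ (coord2 p u) (basePt n p)) (a b c : Model n) :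
    partial2 u p a b c = jet2 p u a b c := by
  rw [← fderiv_bilin_apply hu]
  simp only [coord2_apply]
  rfl

lemma partial1_eq (hα : DifferentiableAt ℝ (coord1 p α) (basePt n p)) (a b : Model n) :
    partial1 α p a b = jet1 p α a b := by
  have h := fderiv_clm_apply hα (differentiableAt_const b)
  have h2 : fderiv ℝ (fun y => coord1 p α y b) (basePt n p) a = jet1 p α a b := by
    rw [h]
    simp
  exact h2

lemma tensorAt_symm (hv : v.Symmetric) (x : X) (a b : Model n) :
    tensorAt v x a b = tensorAt v x b a := hv x a b

lemma jet2_symm (hv : v.Symmetric) (hd : DifferentiableAt ℝ (coord2 p v) (basePt n p))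
    (a b c : Model n) : jet2 p v a b c = jet2 p v a c b := by
  refine fderiv_symm hd (Eventually.of_forall fun y b c => ?_) a b c
  rw [coord2_apply, coord2_apply, hv]

lemma coord2_smul (φ : X → ℝ) (u : Tensor2 n X) :
    coord2 p (fun x => φ x • u x) = fun y => φ (chartInv n p y) • coord2 p u y := by
  funext y
  ext b c
  rw [smul_apply, smul_apply, coord2_apply, coord2_apply]
  rfl

lemma jet0_exp_neg (hφ : DifferentiableAt ℝ (fun y => φ (chartInv n p y)) (basePt n p))
    (a : Model n) :
    jet0 p (fun x => Real.exp (-φ x)) a = Real.exp (-φ p) * -jet0 p φ a := by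
  have h := hφ.hasFDerivAt.fun_neg.exp.fderiv
  rw [chartInv_basePt] at h
  exact DFunLike.congr_fun h a

variable [IsManifold (𝓡 n) ∞ X] {g : Metric n X}

lemma christoffel_eq (hg : DifferentiableAt ℝ (coord2 p g.inner) (basePt n p)) (a b : Model n) :
    christoffel g p a b = christoffelOf (tensorAt g.inner p) (jet2 p g.inner) a b := by
  have h : ∀ c : Model n, chrisForm (jet2 p g.inner) a b c = (1 / 2 : ℝ) *
      (partial2 g.inner p a b c + partial2 g.inner p b a c - partial2 g.inner p c a b) := fun c => by
    rw [chrisForm_apply, partial2_eq hg, partial2_eq hg, partial2_eq hg]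
  have h2 := funext h
  rw [christoffelOf, h2]
  rfl

lemma nabla2_eq (hg : DifferentiableAt ℝ (coord2 p g.inner) (basePt n p))
    (hu : DifferentiableAt ℝ (coord2 p u) (basePt n p)) (a b c : Model n) :
    nabla2 g u p a b c
      = nabla2Of (tensorAt g.inner p) (jet2 p g.inner) (tensorAt u p) (jet2 p u) a b c := by
  have h : nabla2 g u p a b c = partial2 u p a b c - tensorAt u p (christoffel g p a b) c
      - tensorAt u p b (christoffel g p a c) := rfl
  rw [h, partial2_eq hu, christoffel_eq hg, christoffel_eq hg, nabla2Of]

lemma nabla1_eq (hg : DifferentiableAt ℝ (coord2 p g.inner) (basePt n p))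
    (hα : DifferentiableAt ℝ (coord1 p α) (basePt n p)) (a b : Model n) :
    nabla1 g α p a b
      = nabla1Of (tensorAt g.inner p) (jet2 p g.inner) (covectorAt α p) (jet1 p α) a b := by
  have h : nabla1 g α p a b = partial1 α p a b - covectorAt α p (christoffel g p a b) := rfl
  rw [h, partial1_eq hα, christoffel_eq hg, nabla1Of]

lemma mfderiv_eq_jet0 (hφ : DifferentiableAt ℝ (fun y => φ (chartInv n p y)) (basePt n p)) :
    mfderiv (𝓡 n) 𝓘(ℝ, ℝ) φ p = jet0 p φ := by
  -- `mfderiv` is zero by convention at points of non-differentiability, so differentiability on the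
  -- manifold is first recovered from the chart expression.
  have h1 : MDifferentiableAt (𝓡 n) 𝓘(ℝ, ℝ) φ p := by
    have : IsManifold (𝓡 n) 1 X := IsManifold.of_le (n := ∞) (by norm_cast)
    have h2 : MDifferentiableAt (𝓡 n) 𝓘(ℝ, ℝ)
        ((fun y => φ (chartInv n p y)) ∘ extChartAt (𝓡 n) p) p :=
      MDifferentiableAt.comp (I' := 𝓘(ℝ, Model n)) (g := fun y => φ (chartInv n p y)) p
        hφ.mdifferentiableAt (mdifferentiableAt_extChartAt (mem_chart_source _ p))
    refine h2.congr_of_eventuallyEq ?_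
    filter_upwards [extChartAt_source_mem_nhds (I := 𝓡 n) p] with x hx
    exact congrArg φ ((extChartAt (𝓡 n) p).left_inv hx).symm
  rw [h1.mfderiv, ModelWithCorners.range_eq_univ, fderivWithin_univ]
  rfl

lemma grad_eq (hφ : DifferentiableAt ℝ (fun y => φ (chartInv n p y)) (basePt n p)) :
    grad g φ p = sharpOf (tensorAt g.inner p) (jet0 p φ) := by
  rw [← mfderiv_eq_jet0 hφ]
  rfl

lemma star_eq (hv : v.Symmetric) (x : X) (b : Model n) :
    v.star g x b = sharpOf (tensorAt g.inner x) (tensorAt v x b) := by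
  have h2 : v.star g x b = (∑ i, ∑ j, (gramOf (tensorAt g.inner x))⁻¹ i j •
      (tensorAt v x (stdVec i)).smulRight (stdVec j) : Model n →L[ℝ] Model n) b := rfl
  refine Eq.trans h2 ?_
  simp only [sharpOf, tensorAt_symm hv x b, sum_apply, smul_apply,
    ContinuousLinearMap.smulRight_apply, smul_smul]
  rfl

lemma metric_symmetric (g : Metric n X) : Tensor2.Symmetric g.inner := g.symm

lemma nabla2_smul (hg : DifferentiableAt ℝ (coord2 p g.inner) (basePt n p))
    (hu : DifferentiableAt ℝ (coord2 p u) (basePt n p))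
    (hφ : DifferentiableAt ℝ (fun y => φ (chartInv n p y)) (basePt n p)) (a b c : Model n) :
    nabla2 g (fun x => φ x • u x) p a b c
      = φ p * nabla2Of (tensorAt g.inner p) (jet2 p g.inner) (tensorAt u p) (jet2 p u) a b c
        + jet0 p φ a * tensorAt u p b c := by
  have h1 : DifferentiableAt ℝ (coord2 p (fun x => φ x • u x)) (basePt n p) := by
    rw [coord2_smul]
    exact (hasFDerivAt_smul (F := Bilin n) (f := coord2 p u) hφ hu).differentiableAt
  have h2 : jet2 p (fun x => φ x • u x) a b c
      = φ p * jet2 p u a b c + jet0 p φ a * tensorAt u p b c := by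
    rw [jet2, coord2_smul, (hasFDerivAt_smul (F := Bilin n) (f := coord2 p u) hφ hu).fderiv, coord2_basePt, chartInv_basePt]
    simp
  rw [nabla2_eq hg h1, nabla2Of, h2, nabla2Of]
  change _ - φ p * tensorAt u p _ c - φ p * tensorAt u p b _ = _
  ring

/-- The weighted adjoint on `2`-tensors is `∇^* u + u (∇ f, ·)`. -/
lemma weightedAdj2_eq {Ω : TopForm n X}
    (hg : DifferentiableAt ℝ (coord2 p g.inner) (basePt n p))
    (hu : DifferentiableAt ℝ (coord2 p u) (basePt n p))
    (hf : DifferentiableAt ℝ (fun y => logDensity g Ω (chartInv n p y)) (basePt n p))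
    (ξ : Model n) :
    weightedAdj2 g Ω u p ξ
      = - traceOf (tensorAt g.inner p) (fun a b =>
          nabla2Of (tensorAt g.inner p) (jet2 p g.inner) (tensorAt u p) (jet2 p u) a b ξ)
        + tensorAt u p (sharpOf (tensorAt g.inner p) (jet0 p (logDensity g Ω))) ξ := by
  set f := logDensity g Ω with hfdef
  have he : DifferentiableAt ℝ (fun y => Real.exp (-f (chartInv n p y))) (basePt n p) := hf.neg.exp
  have hj := jet0_exp_neg hf
  have h1 := nabla2_smul (φ := fun x => Real.exp (-f x)) hg hu he
  have h2 : adj2 g (fun y => Real.exp (-f y) • u y) p ξ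
      = - traceOf (tensorAt g.inner p) (fun a b => Real.exp (-f p) • (nabla2Of (tensorAt g.inner p)
          (jet2 p g.inner) (tensorAt u p) (jet2 p u) a b ξ
          - jet0 p f a * (tensorAt u p).flip ξ b)) := by
    change - traceOf (tensorAt g.inner p)
      (fun a b => nabla2 g (fun x => Real.exp (-f x) • u x) p a b ξ) = _
    congr 2
    funext a b
    rw [h1, hj, smul_eq_mul, ContinuousLinearMap.flip_apply]
    ring
  have h3 : weightedAdj2 g Ω u p ξ
      = Real.exp (f p) * adj2 g (fun y => Real.exp (-f y) • u y) p ξ := rfl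
  rw [h3, h2, traceOf_smul, traceOf_sub, traceOf_mul, smul_eq_mul,
    ContinuousLinearMap.flip_apply, Real.exp_neg]
  have := Real.exp_ne_zero (f p)
  field_simp
  ring

lemma inverse_star_eq (hv : v.Symmetric) {y : Model n} (hy : y ∈ (extChartAt (𝓡 n) p).target)
    (b : Model n) :
    (coordFrame p y).inverse (v.star g (chartInv n p y) (coordFrame p y b))
      = sharpOf (coord2 p g.inner y) (coord2 p v y b) := by
  have h := star_eq (g := g) hv (chartInv n p y) (frame p y b)
  have h2 := (isMetric_inner g (chartInv n p y)).inverse_sharpOf (frame_isInvertible p hy)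
    (tensorAt v (chartInv n p y) (frame p y b))
  rw [← h] at h2
  exact h2

lemma inverse_oneForm_star_eq {y : Model n} (hy : y ∈ (extChartAt (𝓡 n) p).target) :
    (coordFrame p y).inverse (α.star g (chartInv n p y))
      = sharpOf (coord2 p g.inner y) (coord1 p α y) :=
  (isMetric_inner g (chartInv n p y)).inverse_sharpOf (frame_isInvertible p hy)
    (covectorAt α (chartInv n p y))

lemma coord2_isMetric (g : Metric n X) (p : X) : IsMetric (coord2 p g.inner (basePt n p)) := by
  rw [coord2_basePt]
  exact isMetric_inner g p

/-- The covariant derivative commutes with raising the index of a `1`-form. -/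
lemma nablaVec_star_eq (hg : DifferentiableAt ℝ (coord2 p g.inner) (basePt n p))
    (hα : DifferentiableAt ℝ (coord1 p α) (basePt n p)) (a : Model n) :
    nablaVec g (α.star g) p a = sharpOf (tensorAt g.inner p)
      (nabla1Of (tensorAt g.inner p) (jet2 p g.inner) (covectorAt α p) (jet1 p α) a) := by
  have h1 : (fun y => (coordFrame p y).inverse (α.star g (chartInv n p y))) =ᶠ[𝓝 (basePt n p)]
      fun y => sharpOf (coord2 p g.inner y) (coord1 p α y) :=
    (target_mem_nhds p).mono fun y hy => inverse_oneForm_star_eq hy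
  have h2 : partialVec (α.star g) p a = sharpOf (tensorAt g.inner p) (fun c => jet1 p α a c
      - jet2 p g.inner a (sharpOf (tensorAt g.inner p) (covectorAt α p)) c) := by
    have h3 := fderiv_sharpOf hg hα (coord2_isMetric g p) a
    rw [coord2_basePt, coord1_basePt, ← h1.fderiv_eq] at h3
    exact h3
  have h3 : nablaVec g (α.star g) p a = partialVec (α.star g) p a
      + christoffel g p a (sharpOf (tensorAt g.inner p) (covectorAt α p)) := rfl
  rw [h3, christoffel_eq hg, h2]
  exact (isMetric_inner g p).sharpOf_nabla1Of (jet2_symm (metric_symmetric g) hg) _ _ a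

/-- The covariant derivative commutes with raising an index of a symmetric `2`-tensor, here with a
weight. -/
lemma nablaEnd_smul_star_eq (hg : DifferentiableAt ℝ (coord2 p g.inner) (basePt n p))
    (hv : v.Symmetric) (hd : DifferentiableAt ℝ (coord2 p v) (basePt n p))
    (hφ : DifferentiableAt ℝ (fun y => φ (chartInv n p y)) (basePt n p)) (a b : Model n) :
    nablaEnd g (fun x => φ x • v.star g x) p a b
      = φ p • sharpOf (tensorAt g.inner p)
          (nabla2Of (tensorAt g.inner p) (jet2 p g.inner) (tensorAt v p) (jet2 p v) a b)
        + jet0 p φ a • sharpOf (tensorAt g.inner p) (tensorAt v p b) := by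
  have hdb : DifferentiableAt ℝ (fun y => coord2 p v y b) (basePt n p) :=
    hd.clm_apply (differentiableAt_const b)
  have h1 : (fun y => (coordFrame p y).inverse
      ((φ (chartInv n p y) • v.star g (chartInv n p y)) (coordFrame p y b))) =ᶠ[𝓝 (basePt n p)]
      fun y => φ (chartInv n p y) • sharpOf (coord2 p g.inner y) (coord2 p v y b) :=
    (target_mem_nhds p).mono fun y hy => by
      have e1 := map_smul (coordFrame p y).inverse (φ (chartInv n p y))
        (v.star g (chartInv n p y) (coordFrame p y b))
      exact e1.trans (congrArg (φ (chartInv n p y) • ·) (inverse_star_eq (g := g) hv hy b))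
  have h2 : fderiv ℝ (fun y => coord2 p v y b) (basePt n p) a = jet2 p v a b := by
    rw [fderiv_clm_apply hd (differentiableAt_const b)]
    simp
  have h3 := fderiv_sharpOf hg hdb (coord2_isMetric g p) a
  rw [coord2_basePt, coord2_basePt, h2] at h3
  obtain ⟨P, hP⟩ : ∃ P : Model n, P = partialEnd (fun x => φ x • v.star g x) p a b := ⟨_, rfl⟩
  have h4 : P = φ p • sharpOf (tensorAt g.inner p) (fun c => jet2 p v a b c
          - jet2 p g.inner a (sharpOf (tensorAt g.inner p) (tensorAt v p b)) c)
        + jet0 p φ a • sharpOf (tensorAt g.inner p) (tensorAt v p b) := by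
    have h5 := congrArg (fun L : Model n →L[ℝ] Model n => L a)
      (hasFDerivAt_smul hφ (differentiableAt_sharpOf hg hdb (coord2_isMetric g p))).fderiv
    rw [← h1.fderiv_eq] at h5
    rw [hP]
    refine Eq.trans h5 ?_
    simp only [add_apply, smul_apply, ContinuousLinearMap.smulRight_apply]
    rw [h3, chartInv_basePt, coord2_basePt, coord2_basePt]
  have h6 := (isMetric_inner g p).sharpOf_nabla2Of (v := tensorAt v p) (dv := jet2 p v)
    (jet2_symm (metric_symmetric g) hg) a b
  have h7 : nablaEnd g (fun x => φ x • v.star g x) p a b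
      = P + christoffelOf (tensorAt g.inner p) (jet2 p g.inner) a
            (φ p • sharpOf (tensorAt g.inner p) (tensorAt v p b))
        - φ p • sharpOf (tensorAt g.inner p) (tensorAt v p
            (christoffelOf (tensorAt g.inner p) (jet2 p g.inner) a b)) := by
    rw [hP, ← star_eq hv, ← star_eq hv, ← christoffel_eq hg, ← christoffel_eq hg]
    rfl
  refine Eq.trans h7 ?_
  rw [h4, ← h6, (christoffelOf_isLinearMap_right a).map_smul]
  have h8 : ∀ (r s : ℝ) (A B C D : Model n),
      r • A + s • B + r • C - r • D = r • (A + C - D) + s • B := fun r s A B C D => by module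
  exact h8 _ _ _ _ _ _

/-- The weighted adjoint of `v^*`, in terms of the divergence of `v`. -/
lemma weightedAdjEnd_star_eq {Ω : TopForm n X}
    (hg : DifferentiableAt ℝ (coord2 p g.inner) (basePt n p))
    (hv : v.Symmetric) (hd : DifferentiableAt ℝ (coord2 p v) (basePt n p))
    (hf : DifferentiableAt ℝ (fun y => logDensity g Ω (chartInv n p y)) (basePt n p)) :
    weightedAdjEnd g Ω (v.star g) p
      = - sharpOf (tensorAt g.inner p) (fun c => traceOf (tensorAt g.inner p) (fun a b =>
          nabla2Of (tensorAt g.inner p) (jet2 p g.inner) (tensorAt v p) (jet2 p v) a b c))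
        + sharpOf (tensorAt g.inner p) (tensorAt v p
            (sharpOf (tensorAt g.inner p) (jet0 p (logDensity g Ω)))) := by
  set f := logDensity g Ω with hfdef
  have he : DifferentiableAt ℝ (fun y => Real.exp (-f (chartInv n p y))) (basePt n p) := hf.neg.exp
  have hj := jet0_exp_neg hf
  have h1 := nablaEnd_smul_star_eq (φ := fun x => Real.exp (-f x)) hg hv hd he
  have h2 : adjEnd g (fun y => Real.exp (-f y) • v.star g y) p
      = - traceOf (tensorAt g.inner p) (fun a b => Real.exp (-f p) • sharpOf (tensorAt g.inner p)
          (fun c => nabla2Of (tensorAt g.inner p) (jet2 p g.inner) (tensorAt v p) (jet2 p v) a b c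
          - jet0 p f a * tensorAt v p b c)) := by
    change - traceOf (tensorAt g.inner p)
      (fun a b => nablaEnd g (fun x => Real.exp (-f x) • v.star g x) p a b) = _
    congr 2
    funext a b
    refine (h1 a b).trans ?_
    have h8 : ∀ (r s : ℝ) (A B : Model n), r • A + (r * -s) • B = r • (A - s • B) :=
      fun r s A B => by module
    rw [hj, sharpOf_sub, sharpOf_smul]
    exact h8 _ _ _ _
  have h3 : ∀ c, traceOf (tensorAt g.inner p) (fun a b => jet0 p f a * tensorAt v p b c)
      = tensorAt v p (sharpOf (tensorAt g.inner p) (jet0 p f)) c := fun c =>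
    traceOf_mul (jet0 p f) ((tensorAt v p).flip c)
  have h4 : weightedAdjEnd g Ω (v.star g) p
      = Real.exp (f p) • adjEnd g (fun y => Real.exp (-f y) • v.star g y) p := rfl
  rw [h2, traceOf_smul, traceOf_sharpOf] at h4
  simp only [traceOf_sub, h3] at h4
  refine Eq.trans h4 ?_
  change Real.exp (f p) • -(Real.exp (-f p) • (_ : Model n)) = _
  rw [sharpOf_sub, ← smul_neg, smul_smul, ← Real.exp_add, add_neg_cancel, Real.exp_zero, one_smul,
    neg_sub, sub_eq_neg_add]

end Operators

/-! ### First variation of the weighted operators -/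

section Main

open Filter Topology

variable {n : ℕ} {X : Type*} [TopologicalSpace X] [ChartedSpace (Model n) X]
  [IsManifold (𝓡 n) ∞ X] {g : ℝ → Metric n X} {Ω : ℝ → TopForm n X} {v : Tensor2 n X}
  {V : TopForm n X}

lemma logDensity_eventuallyEq (p : X) (g : Metric n X) (Ω : TopForm n X) :
    (fun y => logDensity g Ω (chartInv n p y)) =ᶠ[𝓝 (basePt n p)]
      fun y => logDensityOf (coord2 p g.inner y) (coordTop p Ω y) :=
  (target_mem_nhds p).mono fun _ hy => logDensity_chartInv p g Ω hy

lemma ratio_eventuallyEq (p : X) (V Ω : TopForm n X) :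
    (fun y => V.ratio Ω (chartInv n p y)) =ᶠ[𝓝 (basePt n p)]
      fun y => coordTop p V y / coordTop p Ω y :=
  (target_mem_nhds p).mono fun _ hy => ratio_chartInv p V Ω hy

namespace IsVariation

/-- The jet formulas for the operators of `g_t` require differentiable components at `p`. Having
this for `t` near `0` is enough, since a derivative at `0` is local. -/
lemma eventually_differentiableAt_metric (h : IsVariation g Ω v V) (p : X) :
    ∀ᶠ t in 𝓝 (0 : ℝ), DifferentiableAt ℝ (coord2 p (g t).inner) (basePt n p) := by
  have hc := (h.isCoordVariation p).contDiffAt_two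
  have ht : ContinuousAt (fun t : ℝ => (t, basePt n p)) 0 := by fun_prop
  filter_upwards [ht.eventually (hc.eventually (by simp))] with t ht
  exact DifferentiableAt.comp (g := fun q : ℝ × Model n => coord2 p (g q.1).inner q.2)
    (f := fun y => (t, y)) (basePt n p) (ht.differentiableAt (by simp)) (by fun_prop)

lemma eventually_differentiableAt_logDensity (h : IsVariation g Ω v V) (p : X) :
    ∀ᶠ t in 𝓝 (0 : ℝ), DifferentiableAt ℝ
      (fun y => logDensity (g t) (Ω t) (chartInv n p y)) (basePt n p) := by
  have hc := (h.isCoordVariation p).contDiffAt_logDensityOf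
  have ht : ContinuousAt (fun t : ℝ => (t, basePt n p)) 0 := by fun_prop
  filter_upwards [ht.eventually (hc.eventually (by simp))] with t ht
  refine DifferentiableAt.congr_of_eventuallyEq ?_ (logDensity_eventuallyEq p (g t) (Ω t))
  exact DifferentiableAt.comp
    (g := fun q : ℝ × Model n => logDensityOf (coord2 p (g q.1).inner q.2) (coordTop p (Ω q.1) q.2))
    (f := fun y => (t, y)) (basePt n p) (ht.differentiableAt (by simp)) (by fun_prop)

lemma isJetVariation (h : IsVariation g Ω v V) (p : X) :
    IsJetVariation (fun t => tensorAt (g t).inner p) (fun t => jet2 p (g t).inner) (tensorAt v p)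
      (jet2 p v) := by
  have hJ := (h.isCoordVariation p).isJetVariation
  simp only [coord2_basePt] at hJ
  exact hJ

lemma hasDerivAt_jet0_logDensity (h : IsVariation g Ω v V) (p : X) (b : Model n) :
    HasDerivAt (fun t => jet0 p (logDensity (g t) (Ω t)) b)
      ((1 / 2 : ℝ) * traceOf (tensorAt (g 0).inner p) (nabla2Of (tensorAt (g 0).inner p)
        (jet2 p (g 0).inner) (tensorAt v p) (jet2 p v) b) - jet0 p (V.ratio (Ω 0)) b) 0 := by
  have hJ := (h.isCoordVariation p).hasDerivAt_fderiv_logDensityOf b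
  simp only [coord2_basePt] at hJ
  rw [← (ratio_eventuallyEq p V (Ω 0)).fderiv_eq] at hJ
  have h2 : (fun t => fderiv ℝ (fun y => logDensityOf (coord2 p (g t).inner y)
      (coordTop p (Ω t) y)) (basePt n p) b) = fun t => jet0 p (logDensity (g t) (Ω t)) b := by
    funext t
    rw [jet0, (logDensity_eventuallyEq p (g t) (Ω t)).fderiv_eq]
  rw [h2] at hJ
  exact hJ

lemma differentiableAt_velocity (h : IsVariation g Ω v V) (p : X) :
    DifferentiableAt ℝ (coord2 p v) (basePt n p) :=
  (h.isCoordVariation p).differentiableAt_velocity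

lemma differentiableAt_ratio (h : IsVariation g Ω v V) (p : X) :
    DifferentiableAt ℝ (fun y => V.ratio (Ω 0) (chartInv n p y)) (basePt n p) :=
  (h.isCoordVariation p).differentiableAt_ratio.congr_of_eventuallyEq (ratio_eventuallyEq p V (Ω 0))

/-- The vector field `∇^{*_Ω} v^* + ∇ V^*` in terms of jets. -/
lemma weightedAdjEnd_add_grad_eq (h : IsVariation g Ω v V) (p : X) :
    (weightedAdjEnd (g 0) (Ω 0) (v.star (g 0)) p + grad (g 0) (V.ratio (Ω 0)) p
      : TangentSpace (𝓡 n) p)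
      = - sharpOf (tensorAt (g 0).inner p) (fun c => traceOf (tensorAt (g 0).inner p) (fun a b =>
          nabla2Of (tensorAt (g 0).inner p) (jet2 p (g 0).inner) (tensorAt v p) (jet2 p v) a b c))
        + sharpOf (tensorAt (g 0).inner p) (tensorAt v p
            (sharpOf (tensorAt (g 0).inner p) (jet0 p (logDensity (g 0) (Ω 0)))))
        + sharpOf (tensorAt (g 0).inner p) (jet0 p (V.ratio (Ω 0))) := by
  have h1 := weightedAdjEnd_star_eq (h.eventually_differentiableAt_metric p).self_of_nhds
    h.symm_velocity (h.differentiableAt_velocity p)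
    (h.eventually_differentiableAt_logDensity p).self_of_nhds
  have h2 := grad_eq (g := g 0) (h.differentiableAt_ratio p)
  rw [h1, h2]
  rfl

theorem hasDerivAt_weightedAdj2 (h : IsVariation g Ω v V) {u : Tensor2 n X} (hu : u.Smooth)
    (hs : u.Symmetric) (x : X) (ξ : TangentSpace (𝓡 n) x) :
    HasDerivAt (fun t => 2 * weightedAdj2 (g t) (Ω t) u x ξ)
      (mForm (g 0) v u x ξ
        - 2 * u x (weightedAdjEnd (g 0) (Ω 0) (v.star (g 0)) x + grad (g 0) (V.ratio (Ω 0)) x) ξ)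
      0 := by
  have hud : DifferentiableAt ℝ (coord2 x u) (basePt n x) :=
    (contDiffAt_coord2 x hu).differentiableAt (by simp)
  have hg := (h.eventually_differentiableAt_metric x).self_of_nhds
  have h1 := (h.isJetVariation x).hasDerivAt_weightedAdj2 (tensorAt u x) (tensorAt_symm hs x)
    (jet2 x u) (df := fun t => jet0 x (logDensity (g t) (Ω t))) (dψ := jet0 x (V.ratio (Ω 0)))
    (h.hasDerivAt_jet0_logDensity x) ξ
  have h2 : (fun t => 2 * weightedAdj2 (g t) (Ω t) u x ξ) =ᶠ[𝓝 0] fun t =>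
      2 * (- traceOf (tensorAt (g t).inner x) (fun a b =>
          nabla2Of (tensorAt (g t).inner x) (jet2 x (g t).inner) (tensorAt u x) (jet2 x u) a b ξ)
        + tensorAt u x (sharpOf (tensorAt (g t).inner x)
          (jet0 x (logDensity (g t) (Ω t)))) ξ) := by
    filter_upwards [h.eventually_differentiableAt_metric x,
      h.eventually_differentiableAt_logDensity x] with t h3 h4
    exact congrArg (2 * ·) (weightedAdj2_eq h3 hud h4 ξ)
  refine (h1.congr_of_eventuallyEq h2).congr_deriv ?_
  have h5 : mForm (g 0) v u x ξ = traceOf (tensorAt (g 0).inner x) (fun a b =>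
      2 * nabla2Of (tensorAt (g 0).inner x) (jet2 x (g 0).inner) (tensorAt u x) (jet2 x u) a
          (sharpOf (tensorAt (g 0).inner x) (tensorAt v x b)) ξ
        + nabla2Of (tensorAt (g 0).inner x) (jet2 x (g 0).inner) (tensorAt v x) (jet2 x v) ξ
          (sharpOf (tensorAt (g 0).inner x) (tensorAt u x a)) b) := by
    change traceOf (tensorAt (g 0).inner x) (fun a b =>
      2 * nabla2 (g 0) u x a (v.star (g 0) x b) ξ + nabla2 (g 0) v x ξ (u.star (g 0) x a) b) = _
    congr 1
    funext a b
    have e1 := nabla2_eq hg hud a (v.star (g 0) x b) ξ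
    have e2 := nabla2_eq hg (h.differentiableAt_velocity x) ξ (u.star (g 0) x a) b
    rw [e1, e2, star_eq h.symm_velocity, star_eq hs]
  rw [h5, h.weightedAdjEnd_add_grad_eq x]
  rfl

theorem hasDerivAt_weightedDiv (h : IsVariation g Ω v V) {α : OneForm n X} (hα : α.Smooth)
    (x : X) :
    HasDerivAt (fun t => weightedDiv (g t) (Ω t) α x)
      (- metricTrace (g 0) x (fun a b =>
          (g 0).inner x (nablaVec (g 0) (α.star (g 0)) x a) (v.star (g 0) x b))
        + α x (weightedAdjEnd (g 0) (Ω 0) (v.star (g 0)) x + grad (g 0) (V.ratio (Ω 0)) x)) 0 := by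
  have hαd : DifferentiableAt ℝ (coord1 x α) (basePt n x) :=
    (contDiffAt_coord1 x hα).differentiableAt (by simp)
  have hg := (h.eventually_differentiableAt_metric x).self_of_nhds
  have h1 := (h.isJetVariation x).hasDerivAt_weightedDiv (covectorAt α x)
    (jet1 x α) (df := fun t => jet0 x (logDensity (g t) (Ω t))) (dψ := jet0 x (V.ratio (Ω 0)))
    (h.hasDerivAt_jet0_logDensity x)
  have h2 : (fun t => weightedDiv (g t) (Ω t) α x) =ᶠ[𝓝 0] fun t =>
      traceOf (tensorAt (g t).inner x)
          (nabla1Of (tensorAt (g t).inner x) (jet2 x (g t).inner) (covectorAt α x) (jet1 x α))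
        - covectorAt α x (sharpOf (tensorAt (g t).inner x)
          (jet0 x (logDensity (g t) (Ω t)))) := by
    filter_upwards [h.eventually_differentiableAt_metric x,
      h.eventually_differentiableAt_logDensity x] with t h3 h4
    have e1 := funext fun a => funext fun b => nabla1_eq h3 hαd a b
    have e2 := grad_eq (g := g t) h4
    rw [← e1, ← e2]
    rfl
  refine (h1.congr_of_eventuallyEq h2).congr_deriv ?_
  -- Raising the index commutes with `∇`, so pairing `∇ α^*` with `v^*` under `g` gives back `∇α(eₖ,
  -- v^* eₖ)`, the term produced by the varying inverse metric.
  have h5 : metricTrace (g 0) x (fun a b =>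
      (g 0).inner x (nablaVec (g 0) (α.star (g 0)) x a) (v.star (g 0) x b))
      = traceOf (tensorAt (g 0).inner x) (fun a b =>
          nabla1Of (tensorAt (g 0).inner x) (jet2 x (g 0).inner) (covectorAt α x) (jet1 x α) a
            (sharpOf (tensorAt (g 0).inner x) (tensorAt v x b))) := by
    change traceOf (tensorAt (g 0).inner x) (fun a b =>
      tensorAt (g 0).inner x (nablaVec (g 0) (α.star (g 0)) x a) (v.star (g 0) x b)) = _
    congr 1
    funext a b
    rw [nablaVec_star_eq hg hαd, star_eq h.symm_velocity]
    exact (isMetric_inner (g 0) x).apply_sharpOf (LinearMap.toContinuousLinearMap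
      ((nabla1Of_isLinearMap (covectorAt α x) (jet1 x α) a).mk' _)) _
  rw [h5, h.weightedAdjEnd_add_grad_eq x]
  rfl

end IsVariation

end Main

end WeightedVariation

end

theorem mainTheorem6 {n : ℕ} {X : Type*} [TopologicalSpace X]
    [ChartedSpace (WeightedVariation.Model n) X] [IsManifold (𝓡 n) ∞ X]
    (g : ℝ → WeightedVariation.Metric n X) (Ω : ℝ → WeightedVariation.TopForm n X)
    (v : WeightedVariation.Tensor2 n X) (V : WeightedVariation.TopForm n X)
    (h : WeightedVariation.IsVariation g Ω v V) :
    (∀ u : WeightedVariation.Tensor2 n X, u.Smooth → u.Symmetric →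
      ∀ (x : X) (ξ : TangentSpace (𝓡 n) x),
        HasDerivAt (fun t => 2 * WeightedVariation.weightedAdj2 (g t) (Ω t) u x ξ)
          (WeightedVariation.mForm (g 0) v u x ξ
            - 2 * u x (WeightedVariation.weightedAdjEnd (g 0) (Ω 0) (v.star (g 0)) x
              + WeightedVariation.grad (g 0) (V.ratio (Ω 0)) x) ξ) 0) ∧
    (∀ α : WeightedVariation.OneForm n X, α.Smooth → ∀ x : X,
        HasDerivAt (fun t => WeightedVariation.weightedDiv (g t) (Ω t) α x)
          (- WeightedVariation.metricTrace (g 0) x (fun a b =>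
              (g 0).inner x (WeightedVariation.nablaVec (g 0) (α.star (g 0)) x a)
                (v.star (g 0) x b))
            + α x (WeightedVariation.weightedAdjEnd (g 0) (Ω 0) (v.star (g 0)) x
              + WeightedVariation.grad (g 0) (V.ratio (Ω 0)) x)) 0) := by
  exact ⟨fun u hu hs x ξ => h.hasDerivAt_weightedAdj2 hu hs x ξ,
    fun α hα x => h.hasDerivAt_weightedDiv hα x⟩
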